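/- Let $W$ be a standard Brownian motion on a probability space, and let $T,S_0,I_0,v_0>0$, $\lambda\in(0,1)$ and $\bar\sigma\in\mathbb R$ be constants. Let $r,\rho,\sigma\in L^\infty(0,T)$ be deterministic functions with $0<\sigma_*<\sigma(t)<\sigma^*<\infty$ for almost every $t\in(0,T)$, where $\sigma_*,\sigma^*$ are constants. Let $S$ be the solution of $dS_t=\rho(t)S_t\,dt+\sigma(t)S_t\,dW_t$ started at $S_0$, that is, $$S_t=S_0\exp\Big(\int_0^t\big(\rho(s)-\tfrac12\sigma(s)^2\big)ds+\int_0^t\sigma(s)\,dW_s\Big).$$ For $N\ge1$ put $\Delta t=T/N$, $t_n=n\Delta t$, $v_0^{(N)}=u_0^{(N)}=v_0$ and, for $1\le n\le N$, $$v_n^{(N)}=\lambda v_{n-1}^{(N)}+\frac{1-\lambda}{\Delta t}\Big(\frac{S_{t_n}}{S_{t_{n-1}}}-1\Big)^2,\qquad u_n^{(N)}=\lambda u_{n-1}^{(N)}+\frac{1-\lambda}{\Delta t}\Big(\int_{t_{n-1}}^{t_n}\sigma(t)\,dW_t\Big)^2 .$$ Let $I^{(N)}$ be the index with $I^{(N)}_0=I_0$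 and $$\frac{dI_t^{(N)}}{I_t^{(N)}}=\big(1-w_{n-1}\big)r(t)\,dt+w_{n-1}\frac{dS_t}{S_t},\quad t\in[t_{n-1},t_n),\qquad w_{n-1}=\frac{\bar\sigma}{\sqrt{v_{n-1}^{(N)}}},$$ that is, $I^{(N)}_{t_n}=I^{(N)}_{t_{n-1}}\exp\big(\int_{t_{n-1}}^{t_n}[(1-w_{n-1})r+w_{n-1}\rho-\tfrac12w_{n-1}^2\sigma^2]\,dt+w_{n-1}\int_{t_{n-1}}^{t_n}\sigma\,dW_t\big)$, and let $X^{(N)}$ be defined in the same way, with $X_0^{(N)}=I_0$ and with $u_{n-1}^{(N)}$ in place of $v_{n-1}^{(N)}$. Then, as $N\to\infty$: (i) $\log I_T^{(N)}-\log X_T^{(N)}$ converges in distribution to $0$; (ii) the random variable $$\sum_{k=1}^N\Big(\frac{\bar\sigma}{\sqrt{v_{k-1}^{(N)}}}-\frac{\bar\sigma}{\sqrt{u_{k-1}^{(N)}}}\Big)\int_{t_{k-1}}^{t_k}[\rho(t)-r(t)]\,dt+\frac12\sum_{k=1}^N\Big(\frac{\bar\sigma^2}{v_{k-1}^{(N)}}-\frac{\bar\sigma^2}{u_{k-1}^{(N)}}\Big)\int_{t_{k-1}}^{t_k}\sigma(t)^2\,dt+\sum_{k=1}^N\Big(\frac{\bar\sigma}{\sqrt{v_{k-1}^{(N)}}}-\frac{\bar\sigma}{\sqrt{u_{k-1}^{(N)}}}\Big)\int_{t_{k-1}}^{t_k}\sigma(t)\,dW_t$$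 converges in distribution to $0$; (iii) $I_T^{(N)}$ converges in distribution if and only if $X_T^{(N)}$ converges in distribution; more precisely, for every probability law $\nu$ on $\mathbb R$, $I_T^{(N)}$ converges in distribution to $\nu$ if and only if $X_T^{(N)}$ does. -/

import Mathlib

open MeasureTheory ProbabilityTheory Filter
open scoped NNReal ENNReal Topology

noncomputable section

namespace VolTarget

variable {Ω : Type*} [MeasurableSpace Ω]

/-! ### The Wiener integral of a deterministic square integrable function -/

/-- The step function `∑ₜ c t • 𝟙_{(0, t]}` on `ℝ`, where `c` is a finitely supported family of
coefficients. Since `𝟙_{(a, b]} = 𝟙_{(0, b]} - 𝟙_{(0, a]}`, these are exactly the finite linear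
combinations of indicators of intervals `(a, b]` with `0 ≤ a ≤ b`. -/
def stepFun (c : ℝ≥0 →₀ ℝ) (x : ℝ) : ℝ :=
  c.sum fun t y ↦ (Set.Ioc (0 : ℝ) (t : ℝ)).indicator (fun _ ↦ y) x

/-- The integral of `stepFun c` against the process `W`: the linear map which sends
`𝟙_{(0, t]}` to `W t - W 0`, hence `𝟙_{(a, b]}` to `W b - W a`. -/
def stepIntegral (W : ℝ≥0 → Ω → ℝ) (c : ℝ≥0 →₀ ℝ) (ω : Ω) : ℝ :=
  c.sum fun t y ↦ y * (W t ω - W 0 ω)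

/-- `Y` is (a version of) the Wiener integral `∫ f dW`: it is the `L²(P)`-limit of the integrals
of some sequence of step functions which converges to `f` in `L²(ℝ)`. -/
structure IsWienerIntegral (W : ℝ≥0 → Ω → ℝ) (P : Measure Ω) (f : ℝ → ℝ) (Y : Ω → ℝ) : Prop where
  memLp : MemLp Y 2 P
  approx : ∃ φ : ℕ → (ℝ≥0 →₀ ℝ),
    Tendsto (fun n ↦ eLpNorm (fun x ↦ stepFun (φ n) x - f x) 2 (volume : Measure ℝ))
      atTop (𝓝 0) ∧
    Tendsto (fun n ↦ eLpNorm (fun ω ↦ stepIntegral W (φ n) ω - Y ω) 2 P) atTop (𝓝 0)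

open Classical in
/-- The Wiener integral `∫_a^b f(t) dW_t` for `0 ≤ a ≤ b`, a random variable which is determined
up to a `P`-null set (when `W` is a Brownian motion and `f` is square integrable on `(a, b]`). -/
def wienerIntegral (W : ℝ≥0 → Ω → ℝ) (P : Measure Ω) (f : ℝ → ℝ) (a b : ℝ) : Ω → ℝ :=
  if h : ∃ Y, IsWienerIntegral W P ((Set.Ioc a b).indicator f) Y then h.choose else 0

/-! ### The risky asset and the volatility target indices -/

/-- The constants and deterministic coefficient functions of the model. -/
structure Model where
  /-- the time horizon -/
  T : ℝ
  /-- the initial price of the risky asset -/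
  S₀ : ℝ
  /-- the initial value of the index -/
  I₀ : ℝ
  /-- the initial realised variance -/
  v₀ : ℝ
  /-- the weight of the exponential moving average -/
  lam : ℝ
  /-- the target volatility -/
  sbar : ℝ
  /-- the risk free rate -/
  r : ℝ → ℝ
  /-- the drift of the risky asset -/
  ρ : ℝ → ℝ
  /-- the volatility of the risky asset -/
  σ : ℝ → ℝ

namespace Model

/-- The observation window `Δt = T / N`. -/
def dt (M : Model) (N : ℕ) : ℝ := M.T / N

/-- The observation times `tₙ = n Δt`. -/
def time (M : Model) (N n : ℕ) : ℝ := n * M.dt N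

/-- The risky asset, that is the solution
`S_t = S₀ exp (∫₀ᵗ (ρ - σ² / 2) ds + ∫₀ᵗ σ dW)` of `dS = ρ S dt + σ S dW`. -/
def S (M : Model) (W : ℝ≥0 → Ω → ℝ) (P : Measure Ω) (t : ℝ) (ω : Ω) : ℝ :=
  M.S₀ * Real.exp ((∫ s in (0 : ℝ)..t, (M.ρ s - M.σ s ^ 2 / 2)) + wienerIntegral W P M.σ 0 t ω)

/-- The realised annual variance `vₙ`, computed from the returns of the risky asset. -/
def v (M : Model) (W : ℝ≥0 → Ω → ℝ) (P : Measure Ω) (N : ℕ) : ℕ → Ω → ℝ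
  | 0, _ => M.v₀
  | n + 1, ω => M.lam * v M W P N n ω + (1 - M.lam) / M.dt N *
      (M.S W P (M.time N (n + 1)) ω / M.S W P (M.time N n) ω - 1) ^ 2

/-- The simplified realised variance `uₙ`, computed from the Wiener increments `∫ σ dW`. -/
def u (M : Model) (W : ℝ≥0 → Ω → ℝ) (P : Measure Ω) (N : ℕ) : ℕ → Ω → ℝ
  | 0, _ => M.v₀
  | n + 1, ω => M.lam * u M W P N n ω + (1 - M.lam) / M.dt N *
      (wienerIntegral W P M.σ (M.time N n) (M.time N (n + 1)) ω) ^ 2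

/-- The leverage `σ̄ / √q` for the realised variance `q`. -/
def leverage (M : Model) (q : ℝ) : ℝ := M.sbar / √q

/-- The value at time `tₙ` of the index with realised variance process `q`. On `[tₙ, tₙ₊₁)` the
index solves `dJ / J = (1 - w) r dt + w dS / S`, where the leverage `w = σ̄ / √qₙ` is known at time
`tₙ`; as `dS / S = ρ dt + σ dW`, the solution satisfies
`J_{tₙ₊₁} = J_{tₙ} exp (∫ ((1 - w) r + w ρ - w² σ² / 2) dt + w ∫ σ dW)`
with integrals over `[tₙ, tₙ₊₁]`. -/
def index (M : Model) (W : ℝ≥0 → Ω → ℝ) (P : Measure Ω) (N : ℕ) (q : ℕ → Ω → ℝ) : ℕ → Ω → ℝ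
  | 0, _ => M.I₀
  | n + 1, ω => index M W P N q n ω * Real.exp
      ((∫ t in (M.time N n)..(M.time N (n + 1)),
          ((1 - M.leverage (q n ω)) * M.r t + M.leverage (q n ω) * M.ρ t
            - M.leverage (q n ω) ^ 2 * M.σ t ^ 2 / 2))
        + M.leverage (q n ω) * wienerIntegral W P M.σ (M.time N n) (M.time N (n + 1)) ω)

/-- The terminal value `I_T^{(N)}` of the volatility target index (recall `T = t_N`). -/
def I (M : Model) (W : ℝ≥0 → Ω → ℝ) (P : Measure Ω) (N : ℕ) : Ω → ℝ :=
  M.index W P N (M.v W P N) N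

/-- The terminal value `X_T^{(N)}` of the simplified index. -/
def X (M : Model) (W : ℝ≥0 → Ω → ℝ) (P : Measure Ω) (N : ℕ) : Ω → ℝ :=
  M.index W P N (M.u W P N) N

/-- The sum of the drift, variance and martingale differences of the two indices. -/
def remainder (M : Model) (W : ℝ≥0 → Ω → ℝ) (P : Measure Ω) (N : ℕ) (ω : Ω) : ℝ :=
  (∑ k ∈ Finset.range N, (M.sbar / √(M.v W P N k ω) - M.sbar / √(M.u W P N k ω)) *
      ∫ t in (M.time N k)..(M.time N (k + 1)), (M.ρ t - M.r t))
    + 1 / 2 * (∑ k ∈ Finset.range N, (M.sbar ^ 2 / M.v W P N k ω - M.sbar ^ 2 / M.u W P N k ω) *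
      ∫ t in (M.time N k)..(M.time N (k + 1)), M.σ t ^ 2)
    + ∑ k ∈ Finset.range N, (M.sbar / √(M.v W P N k ω) - M.sbar / √(M.u W P N k ω)) *
      wienerIntegral W P M.σ (M.time N k) (M.time N (k + 1)) ω

end Model

/-- The random variables `Y N` converge in distribution, as `N → ∞`, to the law `ν`. -/
def TendstoLaw (P : Measure Ω) [IsProbabilityMeasure P] (Y : ℕ → Ω → ℝ)
    (ν : ProbabilityMeasure ℝ) : Prop :=
  TendstoInDistribution Y atTop (fun x : ℝ ↦ x) (fun _ ↦ P) (ν : Measure ℝ)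

end VolTarget

end

/-!
With probability tending to one, all increments `∫ σ dW` over the windows of length `Δt` are at
most `Δt ^ (5 / 12)` and all realised variances are at least `Δt ^ (1 / 12)`, because a small moving
average forces the last 28 increments, which are independent, to be small simultaneously. On this
event the squared returns of the asset differ from the squared increments by `O(Δt ^ (5 / 4))`, so
that `v - u = O(Δt ^ (1 / 4))` and `max |1 / v - 1 / u|` tends to `0` in probability. As
`(√a - √b) ^ 2 ≤ |a - b|`, so does the largest difference of the leverages.

This bounds the drift and variance sums by a small factor times the total mass of their integrands.
In the martingale sum, truncating the predictable leverage differences at `η` changes nothing with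
probability tending to one and leaves a second moment of order `η ^ 2`. The difference of the
logarithms of the indices is the sum of these three terms up to the factor of the variance sum, and
Slutsky's theorem transfers convergence in distribution from one index to the other.
-/

namespace VolTarget

section WienerIntegral

open scoped RealInnerProductSpace

lemma coeFn_linearCombination_toLp {ι α : Type*} [MeasurableSpace α] {μ : Measure α} {p : ℝ≥0∞}
    {g : ι → α → ℝ} (hg : ∀ i, MemLp (g i) p μ) (c : ι →₀ ℝ) :
    Finsupp.linearCombination ℝ (fun i ↦ (hg i).toLp (g i)) c =ᵐ[μ]
      fun x ↦ c.sum fun i y ↦ y * g i x := by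
  set T := Finsupp.linearCombination ℝ fun i ↦ (hg i).toLp (g i) with hT
  induction c using Finsupp.induction_linear with
  | zero =>
    rw [map_zero]
    exact Lp.coeFn_zero ℝ p μ
  | add c d hc hd =>
    rw [map_add]
    filter_upwards [Lp.coeFn_add (T c) (T d), hc, hd] with x hx hcx hdx
    rw [hx, Pi.add_apply, hcx, hdx,
      Finsupp.sum_add_index' (fun _ ↦ zero_mul _) fun _ _ _ ↦ add_mul _ _ _]
  | single i y =>
    rw [hT, Finsupp.linearCombination_single]
    filter_upwards [Lp.coeFn_smul y ((hg i).toLp (g i)), (hg i).coeFn_toLp] with x hx hgx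
    rw [hx, Pi.smul_apply, hgx, Finsupp.sum_single_index (zero_mul _), smul_eq_mul]

lemma norm_linearCombination_eq_of_inner_eq {ι E F : Type*} [NormedAddCommGroup E]
    [InnerProductSpace ℝ E] [NormedAddCommGroup F] [InnerProductSpace ℝ F] {e : ι → E} {f : ι → F}
    (h : ∀ i j, ⟪e i, e j⟫ = ⟪f i, f j⟫) (c : ι →₀ ℝ) :
    ‖Finsupp.linearCombination ℝ e c‖ = ‖Finsupp.linearCombination ℝ f c‖ := by
  rw [norm_eq_sqrt_real_inner, norm_eq_sqrt_real_inner]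
  simp only [Finsupp.linearCombination_apply, Finsupp.sum_inner, Finsupp.inner_sum,
    real_inner_smul_left, real_inner_smul_right, h]

lemma real_inner_toLp {α : Type*} [MeasurableSpace α] {μ : Measure α} {f g : α → ℝ}
    (hf : MemLp f 2 μ) (hg : MemLp g 2 μ) : ⟪hf.toLp f, hg.toLp g⟫ = ∫ x, f x * g x ∂μ := by
  rw [L2.inner_def]
  refine integral_congr_ae ?_
  filter_upwards [hf.coeFn_toLp, hg.coeFn_toLp] with x hfx hgx
  rw [hfx, hgx, RCLike.inner_apply, conj_trivial, mul_comm]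

lemma stepFun_eq_sum_mul (c : ℝ≥0 →₀ ℝ) (x : ℝ) :
    stepFun c x = c.sum fun t y ↦ y * (Set.Ioc (0 : ℝ) t).indicator 1 x :=
  Finset.sum_congr rfl fun t _ ↦ by simp [Set.indicator_apply]

lemma memLp_indicator_Ioc_one (p : ℝ≥0∞) (t : ℝ) :
    MemLp ((Set.Ioc 0 t).indicator (1 : ℝ → ℝ)) p volume :=
  memLp_indicator_const p measurableSet_Ioc 1 (.inr measure_Ioc_lt_top.ne)

/-- `stepFun` as a linear map into `L²(ℝ)`. -/
noncomputable def stepFunLp : (ℝ≥0 →₀ ℝ) →ₗ[ℝ] Lp ℝ 2 (volume : Measure ℝ) :=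
  Finsupp.linearCombination ℝ fun t ↦ (memLp_indicator_Ioc_one 2 t).toLp _

lemma coeFn_stepFunLp (c : ℝ≥0 →₀ ℝ) : stepFunLp c =ᵐ[volume] stepFun c :=
  (coeFn_linearCombination_toLp _ c).trans (.of_forall fun x ↦ (stepFun_eq_sum_mul c x).symm)

lemma integral_indicator_Ioc_mul_indicator_Ioc (s t : ℝ≥0) :
    ∫ x : ℝ, (Set.Ioc (0 : ℝ) s).indicator 1 x * (Set.Ioc (0 : ℝ) t).indicator 1 x
      = (min s t : ℝ) := by
  simp_rw [← Set.inter_indicator_mul, Set.Ioc_inter_Ioc, Pi.one_apply, mul_one, max_self]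
  rw [integral_indicator measurableSet_Ioc]
  simp

variable {Ω : Type*} [MeasurableSpace Ω] {P : Measure Ω} {W : ℝ≥0 → Ω → ℝ}

lemma isGaussianProcess_sub_zero (hW : IsPreBrownianReal W P) :
    IsGaussianProcess (fun t ω ↦ W t ω - W 0 ω) P := by
  simpa only [zero_add] using hW.isGaussianProcess.shift 0

lemma memLp_two_sub_zero (hW : IsPreBrownianReal W P) (t : ℝ≥0) :
    MemLp (fun ω ↦ W t ω - W 0 ω) 2 P :=
  ((isGaussianProcess_sub_zero hW).hasGaussianLaw_eval t).memLp_two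

lemma integral_sub_zero (hW : IsPreBrownianReal W P) (t : ℝ≥0) :
    ∫ ω, (W t ω - W 0 ω) ∂P = 0 := by
  rw [integral_sub (hW.integrable_eval t) (hW.integrable_eval 0), hW.integral_eval,
    hW.integral_eval, sub_zero]

lemma integral_sub_zero_mul_sub_zero (hW : IsPreBrownianReal W P) (s t : ℝ≥0) :
    ∫ ω, (W s ω - W 0 ω) * (W t ω - W 0 ω) ∂P = min s t := by
  have := hW.isGaussianProcess.isProbabilityMeasure
  have h := (hW.shift 0).covariance_fun_eval s t
  simp only [zero_add] at h
  rwa [covariance_eq_sub (memLp_two_sub_zero hW s) (memLp_two_sub_zero hW t),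
    integral_sub_zero hW, zero_mul, sub_zero] at h

/-- `stepIntegral` as a linear map into `L²(P)`. -/
noncomputable def stepIntegralLp (hW : IsPreBrownianReal W P) : (ℝ≥0 →₀ ℝ) →ₗ[ℝ] Lp ℝ 2 P :=
  Finsupp.linearCombination ℝ fun t ↦ (memLp_two_sub_zero hW t).toLp _

lemma coeFn_stepIntegralLp (hW : IsPreBrownianReal W P) (c : ℝ≥0 →₀ ℝ) :
    stepIntegralLp hW c =ᵐ[P] stepIntegral W c :=
  coeFn_linearCombination_toLp _ c

lemma norm_stepIntegralLp (hW : IsPreBrownianReal W P) (c : ℝ≥0 →₀ ℝ) :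
    ‖stepIntegralLp hW c‖ = ‖stepFunLp c‖ :=
  norm_linearCombination_eq_of_inner_eq (fun s t ↦ by
    rw [real_inner_toLp, real_inner_toLp, integral_sub_zero_mul_sub_zero hW,
      integral_indicator_Ioc_mul_indicator_Ioc, NNReal.coe_min]) c

lemma hasGaussianLaw_stepIntegral (hW : IsPreBrownianReal W P) (c : ℝ≥0 →₀ ℝ) :
    HasGaussianLaw (stepIntegral W c) P :=
  ((isGaussianProcess_sub_zero hW).smul c).hasGaussianLaw_fun_sum (I := c.support)

lemma integral_stepIntegral (hW : IsPreBrownianReal W P) (c : ℝ≥0 →₀ ℝ) :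
    ∫ ω, stepIntegral W c ω ∂P = 0 := by
  have := hW.isGaussianProcess.isProbabilityMeasure
  simp only [stepIntegral, Finsupp.sum]
  rw [integral_finsetSum _ fun t _ ↦
    ((memLp_two_sub_zero hW t).integrable one_le_two).const_mul _]
  simp only [integral_const_mul, integral_sub_zero hW, mul_zero, Finset.sum_const_zero]

lemma nnnorm_Lp_sq_eq_variance [IsProbabilityMeasure P] (Y : Lp ℝ 2 P) (hY : ∫ ω, Y ω ∂P = 0) :
    (‖Y‖₊ ^ 2 : ℝ≥0) = Var[Y; P] := by
  rw [variance_of_integral_eq_zero (Lp.aestronglyMeasurable Y).aemeasurable hY, NNReal.coe_pow,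
    coe_nnnorm, ← real_inner_self_eq_norm_sq, L2.inner_def]
  simp only [RCLike.inner_apply, conj_trivial, sq]

lemma map_stepIntegralLp (hW : IsPreBrownianReal W P) (c : ℝ≥0 →₀ ℝ) :
    P.map (stepIntegralLp hW c) = gaussianReal 0 (‖stepIntegralLp hW c‖₊ ^ 2) := by
  have := hW.isGaussianProcess.isProbabilityMeasure
  have hlaw : HasGaussianLaw (stepIntegralLp hW c) P :=
    (hasGaussianLaw_stepIntegral hW c).congr (coeFn_stepIntegralLp hW c).symm
  have hmean : ∫ ω, stepIntegralLp hW c ω ∂P = 0 :=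
    (integral_congr_ae (coeFn_stepIntegralLp hW c)).trans (integral_stepIntegral hW c)
  rw [hlaw.map_eq_gaussianReal, hmean, ← nnnorm_Lp_sq_eq_variance _ hmean, Real.toNNReal_coe]

lemma isClosed_setOf_map_eq_gaussianReal [IsProbabilityMeasure P] :
    IsClosed {Y : Lp ℝ 2 P | P.map Y = gaussianReal 0 (‖Y‖₊ ^ 2)} := by
  refine isSeqClosed_iff_isClosed.1 fun Z Y hZ hlim ↦ ?_
  have hmeas (Y : Lp ℝ 2 P) : AEMeasurable Y P := (Lp.aestronglyMeasurable Y).aemeasurable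
  have := Measure.isProbabilityMeasure_map (hmeas Y)
  have hlaw := ProbabilityMeasure.tendsto_iff_tendsto_charFun.1
    ((tendstoInMeasure_of_tendsto_Lp hlim).tendstoInDistribution fun n ↦ hmeas (Z n)).tendsto
  refine Measure.ext_of_charFun (funext fun t ↦ tendsto_nhds_unique (hlaw t) ?_)
  have hcont : Continuous fun Y : Lp ℝ 2 P ↦ charFun (gaussianReal 0 (‖Y‖₊ ^ 2)) t := by
    simp only [charFun_gaussianReal]
    fun_prop
  exact ((hcont.tendsto Y).comp hlim).congr fun n ↦ congrArg (charFun · t) (hZ n).symm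

/-- The graph of the Wiener integral as a map from (a subspace of) `L²(ℝ)` to `L²(P)`. -/
noncomputable def wienerGraph (hW : IsPreBrownianReal W P) :
    Submodule ℝ (Lp ℝ 2 (volume : Measure ℝ) × Lp ℝ 2 P) :=
  (LinearMap.range (stepFunLp.prod (stepIntegralLp hW))).topologicalClosure

lemma isWienerIntegral_iff (hW : IsPreBrownianReal W P) {f : ℝ → ℝ} (hf : MemLp f 2 volume)
    {Y : Ω → ℝ} : IsWienerIntegral W P f Y ↔
      ∃ hY : MemLp Y 2 P, (hf.toLp f, hY.toLp Y) ∈ wienerGraph hW := by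
  have hfun (φ : ℕ → ℝ≥0 →₀ ℝ) : Tendsto (fun n ↦ stepFunLp (φ n)) atTop (𝓝 (hf.toLp f)) ↔
      Tendsto (fun n ↦ eLpNorm (fun x ↦ stepFun (φ n) x - f x) 2 volume) atTop (𝓝 0) := by
    rw [Lp.tendsto_Lp_iff_tendsto_eLpNorm]
    refine tendsto_congr fun n ↦ eLpNorm_congr_ae ?_
    filter_upwards [coeFn_stepFunLp (φ n)] with x hx
    rw [Pi.sub_apply, hx]
  have hint (hY : MemLp Y 2 P) (φ : ℕ → ℝ≥0 →₀ ℝ) :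
      Tendsto (fun n ↦ stepIntegralLp hW (φ n)) atTop (𝓝 (hY.toLp Y)) ↔
      Tendsto (fun n ↦ eLpNorm (fun ω ↦ stepIntegral W (φ n) ω - Y ω) 2 P) atTop (𝓝 0) := by
    rw [Lp.tendsto_Lp_iff_tendsto_eLpNorm]
    refine tendsto_congr fun n ↦ eLpNorm_congr_ae ?_
    filter_upwards [coeFn_stepIntegralLp hW (φ n)] with ω hω
    rw [Pi.sub_apply, hω]
  refine ⟨fun ⟨hY, φ, hφf, hφY⟩ ↦ ⟨hY, mem_closure_iff_seq_limit.2
    ⟨_, fun n ↦ ⟨φ n, rfl⟩, ((hfun φ).2 hφf).prodMk_nhds ((hint hY φ).2 hφY)⟩⟩, ?_⟩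
  rintro ⟨hY, h⟩
  obtain ⟨x, hx, hlim⟩ := mem_closure_iff_seq_limit.1 h
  choose φ hφ using hx
  obtain rfl : (fun n ↦ stepFunLp.prod (stepIntegralLp hW) (φ n)) = x := funext hφ
  exact ⟨hY, φ, (hfun φ).1 hlim.fst_nhds, (hint hY φ).1 hlim.snd_nhds⟩

lemma norm_snd_of_mem_wienerGraph (hW : IsPreBrownianReal W P)
    {p : Lp ℝ 2 (volume : Measure ℝ) × Lp ℝ 2 P} (hp : p ∈ wienerGraph hW) : ‖p.2‖ = ‖p.1‖ := by
  refine closure_minimal ?_ (isClosed_eq continuous_snd.norm continuous_fst.norm) hp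
  rintro _ ⟨c, rfl⟩
  exact norm_stepIntegralLp hW c

lemma inner_snd_of_mem_wienerGraph (hW : IsPreBrownianReal W P)
    {p q : Lp ℝ 2 (volume : Measure ℝ) × Lp ℝ 2 P} (hp : p ∈ wienerGraph hW)
    (hq : q ∈ wienerGraph hW) : ⟪p.2, q.2⟫ = ⟪p.1, q.1⟫ := by
  simp only [real_inner_eq_norm_add_mul_self_sub_norm_mul_self_sub_norm_mul_self_div_two,
    ← Prod.snd_add, ← Prod.fst_add, norm_snd_of_mem_wienerGraph hW hp,
    norm_snd_of_mem_wienerGraph hW hq, norm_snd_of_mem_wienerGraph hW (add_mem hp hq)]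

lemma map_snd_of_mem_wienerGraph (hW : IsPreBrownianReal W P)
    {p : Lp ℝ 2 (volume : Measure ℝ) × Lp ℝ 2 P} (hp : p ∈ wienerGraph hW) :
    P.map p.2 = gaussianReal 0 (‖p.2‖₊ ^ 2) := by
  have := hW.isGaussianProcess.isProbabilityMeasure
  refine closure_minimal ?_ (isClosed_setOf_map_eq_gaussianReal.preimage continuous_snd) hp
  rintro _ ⟨c, rfl⟩
  exact map_stepIntegralLp hW c

lemma ae_eq_zero_of_integral_Ioc_eq_zero {g : ℝ → ℝ} (hg : LocallyIntegrable g volume)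
    (h : ∀ t : ℝ≥0, ∫ x in Set.Ioc (0 : ℝ) t, g x = 0) : ∀ᵐ x, 0 < x → g x = 0 := by
  filter_upwards [LocallyIntegrable.ae_hasDerivAt_integral hg] with x hx hx0
  refine (hx 0).unique ((hasDerivAt_const x (0 : ℝ)).congr_of_eventuallyEq ?_)
  filter_upwards [lt_mem_nhds hx0] with y hy
  rw [intervalIntegral.integral_of_le hy.le]
  exact h ⟨y, hy.le⟩

lemma ae_eq_zero_of_mem_orthogonal_range_stepFunLp {g : Lp ℝ 2 (volume : Measure ℝ)}
    (hg : g ∈ (LinearMap.range stepFunLp)ᗮ) : ∀ᵐ x, 0 < x → g x = 0 := by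
  refine ae_eq_zero_of_integral_Ioc_eq_zero
    ((Lp.memLp g).locallyIntegrable one_le_two) fun t ↦ ?_
  have h := (Submodule.mem_orthogonal _ _).1 hg _ ⟨Finsupp.single t 1, rfl⟩
  rw [stepFunLp, Finsupp.linearCombination_single, one_smul, L2.inner_def] at h
  rw [← integral_indicator measurableSet_Ioc]
  refine (integral_congr_ae ?_).trans h
  filter_upwards [(memLp_indicator_Ioc_one 2 t).coeFn_toLp] with x hx
  rw [hx, RCLike.inner_apply, conj_trivial, ← Set.indicator_mul_right]
  simp only [Pi.one_apply, mul_one]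

lemma toLp_mem_closure_range_stepFunLp {f : ℝ → ℝ} (hf : MemLp f 2 volume)
    (hf0 : ∀ x ≤ 0, f x = 0) : hf.toLp f ∈ closure (Set.range stepFunLp) := by
  suffices hf.toLp f ∈ (LinearMap.range stepFunLp)ᗮᗮ by
    rwa [Submodule.orthogonal_orthogonal_eq_closure] at this
  refine (Submodule.mem_orthogonal _ _).2 fun g hg ↦ ?_
  rw [L2.inner_def]
  refine integral_eq_zero_of_ae ?_
  filter_upwards [ae_eq_zero_of_mem_orthogonal_range_stepFunLp hg, hf.coeFn_toLp] with x hgx hfx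
  rcases le_or_gt x 0 with hx | hx
  · simp [hfx, hf0 x hx]
  · simp [hgx hx]

lemma exists_isWienerIntegral (hW : IsPreBrownianReal W P) {f : ℝ → ℝ} (hf : MemLp f 2 volume)
    (hf0 : ∀ x ≤ 0, f x = 0) : ∃ Y, IsWienerIntegral W P f Y := by
  obtain ⟨x, hx, hlim⟩ := mem_closure_iff_seq_limit.1 (toLp_mem_closure_range_stepFunLp hf hf0)
  choose φ hφ using hx
  obtain rfl : (fun n ↦ stepFunLp (φ n)) = x := funext hφ
  have hcauchy : CauchySeq fun n ↦ stepIntegralLp hW (φ n) := by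
    simpa only [cauchySeq_iff_tendsto_dist_atTop_0, dist_eq_norm, ← map_sub,
      norm_stepIntegralLp hW] using hlim.cauchySeq
  obtain ⟨Y, hY⟩ := cauchySeq_tendsto_of_complete hcauchy
  refine ⟨Y, (isWienerIntegral_iff hW hf).2 ⟨Lp.memLp Y, mem_closure_iff_seq_limit.2
    ⟨_, fun n ↦ ⟨φ n, rfl⟩, hlim.prodMk_nhds ?_⟩⟩⟩
  rwa [Lp.toLp_coeFn]

lemma IsWienerIntegral.add (hW : IsPreBrownianReal W P) {f g : ℝ → ℝ} (hf : MemLp f 2 volume)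
    (hg : MemLp g 2 volume) {Y Z : Ω → ℝ} (hY : IsWienerIntegral W P f Y)
    (hZ : IsWienerIntegral W P g Z) : IsWienerIntegral W P (f + g) (Y + Z) := by
  obtain ⟨hY, hfY⟩ := (isWienerIntegral_iff hW hf).1 hY
  obtain ⟨hZ, hgZ⟩ := (isWienerIntegral_iff hW hg).1 hZ
  exact (isWienerIntegral_iff hW (hf.add hg)).2 ⟨hY.add hZ, add_mem hfY hgZ⟩

lemma IsWienerIntegral.ae_eq (hW : IsPreBrownianReal W P) {f : ℝ → ℝ} (hf : MemLp f 2 volume)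
    {Y Z : Ω → ℝ} (hY : IsWienerIntegral W P f Y) (hZ : IsWienerIntegral W P f Z) :
    Y =ᵐ[P] Z := by
  obtain ⟨hY, hfY⟩ := (isWienerIntegral_iff hW hf).1 hY
  obtain ⟨hZ, hfZ⟩ := (isWienerIntegral_iff hW hf).1 hZ
  have h := norm_snd_of_mem_wienerGraph hW (sub_mem hfY hfZ)
  rw [Prod.fst_sub, Prod.snd_sub, sub_self, norm_zero, norm_eq_zero, sub_eq_zero] at h
  exact (MemLp.toLp_eq_toLp_iff hY hZ).1 h

lemma IsWienerIntegral.map_eq_gaussianReal (hW : IsPreBrownianReal W P) {f : ℝ → ℝ}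
    (hf : MemLp f 2 volume) {Y : Ω → ℝ} (hY : IsWienerIntegral W P f Y) :
    P.map Y = gaussianReal 0 (∫ x, f x ^ 2).toNNReal := by
  obtain ⟨hY, hfY⟩ := (isWienerIntegral_iff hW hf).1 hY
  have hnorm : (‖hY.toLp Y‖₊ ^ 2 : ℝ≥0) = ∫ x, f x ^ 2 := by
    rw [NNReal.coe_pow, coe_nnnorm, norm_snd_of_mem_wienerGraph hW hfY,
      ← real_inner_self_eq_norm_sq, real_inner_toLp]
    simp only [sq]
  rw [← Measure.map_congr hY.coeFn_toLp, map_snd_of_mem_wienerGraph hW hfY, ← hnorm,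
    Real.toNNReal_coe]

lemma IsWienerIntegral.integral_mul_eq (hW : IsPreBrownianReal W P) {f g : ℝ → ℝ}
    (hf : MemLp f 2 volume) (hg : MemLp g 2 volume) {Y Z : Ω → ℝ} (hY : IsWienerIntegral W P f Y)
    (hZ : IsWienerIntegral W P g Z) : ∫ ω, Y ω * Z ω ∂P = ∫ x, f x * g x := by
  obtain ⟨hY, hfY⟩ := (isWienerIntegral_iff hW hf).1 hY
  obtain ⟨hZ, hgZ⟩ := (isWienerIntegral_iff hW hg).1 hZ
  simpa only [real_inner_toLp] using inner_snd_of_mem_wienerGraph hW hfY hgZ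

lemma IsWienerIntegral.covariance_eq (hW : IsPreBrownianReal W P) {f g : ℝ → ℝ}
    (hf : MemLp f 2 volume) (hg : MemLp g 2 volume) {Y Z : Ω → ℝ} (hY : IsWienerIntegral W P f Y)
    (hZ : IsWienerIntegral W P g Z) : cov[Y, Z; P] = ∫ x, f x * g x := by
  have := hW.isGaussianProcess.isProbabilityMeasure
  have hmean : ∫ ω, Y ω ∂P = 0 := by
    rw [← integral_map (f := fun x ↦ x) hY.memLp.aestronglyMeasurable.aemeasurable
      aestronglyMeasurable_id, hY.map_eq_gaussianReal hW hf]
    exact integral_id_gaussianReal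
  rw [covariance_eq_sub hY.memLp hZ.memLp, hmean, zero_mul, sub_zero]
  exact hY.integral_mul_eq hW hf hg hZ

lemma hasGaussianLaw_of_isWienerIntegral (hW : IsPreBrownianReal W P) {ι : Type*} [Finite ι]
    {f : ι → ℝ → ℝ} (hf : ∀ i, MemLp (f i) 2 volume) {Y : ι → Ω → ℝ}
    (hY : ∀ i, IsWienerIntegral W P (f i) (Y i)) : HasGaussianLaw (fun ω i ↦ Y i ω) P := by
  classical
  cases nonempty_fintype ι
  choose hYL hmem using fun i ↦ (isWienerIntegral_iff hW (hf i)).1 (hY i)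
  have hYm : AEMeasurable (fun ω i ↦ Y i ω) P :=
    aemeasurable_pi_lambda _ fun i ↦ (hYL i).aestronglyMeasurable.aemeasurable
  refine ⟨isGaussian_of_isGaussian_map fun L ↦ ?_⟩
  set a : ι → ℝ := fun i ↦ L fun j ↦ if i = j then 1 else 0
  have hsum : (∑ i, a i • ((hf i).toLp (f i), (hYL i).toLp (Y i))) ∈ wienerGraph hW :=
    Submodule.sum_mem _ fun i _ ↦ Submodule.smul_mem _ _ (hmem i)
  have hL : (fun ω ↦ L fun i ↦ Y i ω) =ᵐ[P]
      (∑ i, a i • ((hf i).toLp (f i), (hYL i).toLp (Y i))).2 := by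
    rw [Prod.snd_sum]
    filter_upwards [Lp.coeFn_fun_finsetSum Finset.univ fun i ↦ a i • (hYL i).toLp (Y i),
      ae_all_iff.2 fun i ↦ Lp.coeFn_smul (a i) ((hYL i).toLp (Y i)),
      ae_all_iff.2 fun i ↦ (hYL i).coeFn_toLp] with ω hω hsmul hcoe
    refine ((L : (ι → ℝ) →ₗ[ℝ] ℝ).pi_apply_eq_sum_univ _).trans (.trans ?_ hω.symm)
    refine Finset.sum_congr rfl fun i _ ↦ ?_
    rw [hsmul, Pi.smul_apply, hcoe, smul_eq_mul, smul_eq_mul, mul_comm]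
    rfl
  rw [AEMeasurable.map_map_of_aemeasurable L.continuous.measurable.aemeasurable hYm]
  change IsGaussian (P.map fun ω ↦ L fun i ↦ Y i ω)
  rw [Measure.map_congr hL, map_snd_of_mem_wienerGraph hW hsum]
  infer_instance

lemma iIndepFun_of_isWienerIntegral (hW : IsPreBrownianReal W P) {ι : Type*} {f : ι → ℝ → ℝ}
    (hf : ∀ i, MemLp (f i) 2 volume) {Y : ι → Ω → ℝ} (hY : ∀ i, IsWienerIntegral W P (f i) (Y i))
    (horth : ∀ i j, i ≠ j → ∫ x, f i x * f j x = 0) : iIndepFun Y P := by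
  rw [iIndepFun_iff_finset]
  intro s
  refine (hasGaussianLaw_of_isWienerIntegral hW (fun i : s ↦ hf i)
    fun i ↦ hY i).iIndepFun_of_covariance_eq_zero fun i j hij ↦ ?_
  exact ((hY i).covariance_eq hW (hf i) (hf j) (hY j)).trans
    (horth i j (Subtype.coe_injective.ne hij))

lemma isWienerIntegral_congr {f g : ℝ → ℝ} (h : f =ᵐ[volume] g) :
    IsWienerIntegral W P f = IsWienerIntegral W P g := by
  suffices ∀ {f g : ℝ → ℝ}, f =ᵐ[volume] g → IsWienerIntegral W P f ≤ IsWienerIntegral W P g from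
    (this h).antisymm (this h.symm)
  rintro f g h Y ⟨hY, φ, hφf, hφY⟩
  refine ⟨hY, φ, hφf.congr fun n ↦ eLpNorm_congr_ae ?_, hφY⟩
  filter_upwards [h] with x hx
  rw [hx]

lemma wienerIntegral_congr {f g : ℝ → ℝ} {a b : ℝ}
    (h : (Set.Ioc a b).indicator f =ᵐ[volume] (Set.Ioc a b).indicator g) :
    wienerIntegral W P f a b = wienerIntegral W P g a b := by
  unfold wienerIntegral
  rw [isWienerIntegral_congr h]

lemma isWienerIntegral_wienerIntegral (hW : IsPreBrownianReal W P) {f : ℝ → ℝ} {a b : ℝ}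
    (ha : 0 ≤ a) (hf : MemLp ((Set.Ioc a b).indicator f) 2 volume) :
    IsWienerIntegral W P ((Set.Ioc a b).indicator f) (wienerIntegral W P f a b) := by
  have h : ∃ Y, IsWienerIntegral W P ((Set.Ioc a b).indicator f) Y :=
    exists_isWienerIntegral hW hf fun x hx ↦
      Set.indicator_of_notMem (fun hx' ↦ (ha.trans_lt hx'.1).not_ge hx) _
  rw [wienerIntegral, dif_pos h]
  exact h.choose_spec

lemma wienerIntegral_add_adjacent (hW : IsPreBrownianReal W P) {f : ℝ → ℝ} {a b c : ℝ}
    (ha : 0 ≤ a) (hab : a ≤ b) (hbc : b ≤ c)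
    (hfab : MemLp ((Set.Ioc a b).indicator f) 2 volume)
    (hfbc : MemLp ((Set.Ioc b c).indicator f) 2 volume) :
    wienerIntegral W P f a c =ᵐ[P] wienerIntegral W P f a b + wienerIntegral W P f b c := by
  have hadd := (isWienerIntegral_wienerIntegral hW ha hfab).add hW hfab hfbc
    (isWienerIntegral_wienerIntegral hW (ha.trans hab) hfbc)
  have hind : (Set.Ioc a b).indicator f + (Set.Ioc b c).indicator f
      = (Set.Ioc a c).indicator f := by
    rw [← Set.Ioc_union_Ioc_eq_Ioc hab hbc,
      Set.indicator_union_of_disjoint (Set.Ioc_disjoint_Ioc_of_le le_rfl)]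
    rfl
  have hfac := hind ▸ hfab.add hfbc
  exact (isWienerIntegral_wienerIntegral hW ha hfac).ae_eq hW hfac (hind ▸ hadd)

end WienerIntegral

/-! ### Exponential moving averages of squares -/

/-- The exponential moving average with weight `lam`, initial value `v₀` and time step `h` of the
squares of the sequence `x`; both realised variances `Model.v` and `Model.u` are of this form. -/
noncomputable def ema (lam v₀ h : ℝ) (x : ℕ → ℝ) : ℕ → ℝ
  | 0 => v₀
  | n + 1 => lam * ema lam v₀ h x n + (1 - lam) / h * x n ^ 2

section Ema

variable {lam v₀ h : ℝ} {x y : ℕ → ℝ}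

lemma ema_congr {n : ℕ} (hxy : ∀ k < n, x k = y k) : ema lam v₀ h x n = ema lam v₀ h y n := by
  induction n with
  | zero => rfl
  | succ n ih =>
    rw [ema, ema, hxy n n.lt_succ_self, ih fun k hk ↦ hxy k (hk.trans n.lt_succ_self)]

lemma ema_pos (hlam : lam ∈ Set.Ioo (0 : ℝ) 1) (hv₀ : 0 < v₀) (hh : 0 < h) (n : ℕ) :
    0 < ema lam v₀ h x n := by
  induction n with
  | zero => exact hv₀
  | succ n ih =>
    have hold := mul_pos hlam.1 ih
    have hnew := mul_nonneg (div_pos (sub_pos.2 hlam.2) hh).le (sq_nonneg (x n))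
    simp only [ema]
    linarith

lemma abs_ema_sub_le (hlam : lam ∈ Set.Ioo (0 : ℝ) 1) (hh : 0 < h) {d : ℝ} (hd : 0 ≤ d) (n : ℕ)
    (hxy : ∀ k < n, |x k ^ 2 - y k ^ 2| ≤ d * h) :
    |ema lam v₀ h x n - ema lam v₀ h y n| ≤ d := by
  induction n with
  | zero => simpa [ema]
  | succ n ih =>
    have ih := ih fun k hk ↦ hxy k (hk.trans n.lt_succ_self)
    have hw : 0 ≤ (1 - lam) / h := (div_pos (sub_pos.2 hlam.2) hh).le
    calc |ema lam v₀ h x (n + 1) - ema lam v₀ h y (n + 1)|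
        = |lam * (ema lam v₀ h x n - ema lam v₀ h y n)
            + (1 - lam) / h * (x n ^ 2 - y n ^ 2)| := by simp only [ema]; ring_nf
      _ ≤ lam * |ema lam v₀ h x n - ema lam v₀ h y n|
            + (1 - lam) / h * |x n ^ 2 - y n ^ 2| := by
          refine (abs_add_le _ _).trans_eq ?_
          rw [abs_mul, abs_mul, abs_of_pos hlam.1, abs_of_nonneg hw]
      _ ≤ lam * d + (1 - lam) / h * (d * h) := by
          have := hlam.1
          gcongr
          exact hxy n n.lt_succ_self
      _ = d := by field_simp; ring

lemma pow_mul_ema_le (hlam : lam ∈ Set.Ioo (0 : ℝ) 1) (hh : 0 < h) (n m : ℕ) :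
    lam ^ m * ema lam v₀ h x n ≤ ema lam v₀ h x (n + m) := by
  induction m with
  | zero => simp
  | succ m ih =>
    have hold := mul_le_mul_of_nonneg_left ih hlam.1.le
    have hnew := mul_nonneg (div_pos (sub_pos.2 hlam.2) hh).le (sq_nonneg (x (n + m)))
    rw [← add_assoc, ema, pow_succ']
    linarith

lemma pow_mul_initial_le_ema (hlam : lam ∈ Set.Ioo (0 : ℝ) 1) (hv₀ : 0 < v₀) (hh : 0 < h)
    {n m : ℕ} (hn : n ≤ m) : lam ^ m * v₀ ≤ ema lam v₀ h x n :=
  calc lam ^ m * v₀ ≤ lam ^ n * v₀ :=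
        mul_le_mul_of_nonneg_right (pow_le_pow_of_le_one hlam.1.le hlam.2.le hn) hv₀.le
    _ ≤ ema lam v₀ h x n := by
        simpa only [zero_add, ema] using pow_mul_ema_le (v₀ := v₀) (x := x) hlam hh 0 n

lemma pow_mul_sq_le_ema (hlam : lam ∈ Set.Ioo (0 : ℝ) 1) (hv₀ : 0 < v₀) (hh : 0 < h) {n m k : ℕ}
    (hnk : n ≤ k) (hk : k < n + m) :
    lam ^ m * ((1 - lam) / h * x k ^ 2) ≤ ema lam v₀ h x (n + m) := by
  have hsq : 0 ≤ (1 - lam) / h * x k ^ 2 :=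
    mul_nonneg (div_pos (sub_pos.2 hlam.2) hh).le (sq_nonneg _)
  have hnext : (1 - lam) / h * x k ^ 2 ≤ ema lam v₀ h x (k + 1) :=
    le_add_of_nonneg_left (mul_pos hlam.1 (ema_pos hlam hv₀ hh k)).le
  obtain ⟨j, hj⟩ := Nat.exists_eq_add_of_le (Nat.succ_le_of_lt hk)
  calc lam ^ m * ((1 - lam) / h * x k ^ 2)
      ≤ lam ^ j * ema lam v₀ h x (k + 1) :=
        mul_le_mul (pow_le_pow_of_le_one hlam.1.le hlam.2.le (by lia)) hnext hsq
          (pow_nonneg hlam.1.le _)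
    _ ≤ ema lam v₀ h x (n + m) := hj ▸ pow_mul_ema_le hlam hh (k + 1) j

lemma abs_le_sqrt_of_ema_le (hlam : lam ∈ Set.Ioo (0 : ℝ) 1) (hv₀ : 0 < v₀) (hh : 0 < h)
    {n m k : ℕ} (hnk : n ≤ k) (hk : k < n + m) {θ : ℝ} (hθ : ema lam v₀ h x (n + m) ≤ θ) :
    |x k| ≤ √(θ * h / (lam ^ m * (1 - lam))) := by
  refine Real.abs_le_sqrt ?_
  rw [le_div_iff₀ (mul_pos (pow_pos hlam.1 m) (sub_pos.2 hlam.2))]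
  calc x k ^ 2 * (lam ^ m * (1 - lam))
      = lam ^ m * ((1 - lam) / h * x k ^ 2) * h := by field_simp
    _ ≤ θ * h := mul_le_mul_of_nonneg_right ((pow_mul_sq_le_ema hlam hv₀ hh hnk hk).trans hθ) hh.le

lemma measurable_ema {α : Type*} {_ : MeasurableSpace α} {x : ℕ → α → ℝ} (n : ℕ)
    (hx : ∀ k < n, Measurable (x k)) :
    Measurable fun a ↦ ema lam v₀ h (fun k ↦ x k a) n := by
  induction n with
  | zero => exact measurable_const
  | succ n ih =>
    exact ((ih fun k hk ↦ hx k (hk.trans n.lt_succ_self)).const_mul _).add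
      (((hx n n.lt_succ_self).pow_const 2).const_mul _)

lemma aemeasurable_ema {α : Type*} [MeasurableSpace α] {μ : Measure α} {x : ℕ → α → ℝ} (n : ℕ)
    (hx : ∀ k, AEMeasurable (x k) μ) :
    AEMeasurable (fun a ↦ ema lam v₀ h (fun k ↦ x k a) n) μ :=
  (measurable_ema n fun k _ ↦ measurable_pi_apply k).comp_aemeasurable (aemeasurable_pi_lambda _ hx)

lemma abs_exp_sub_one_sq_sub_sq_le {A r a x : ℝ} (hA : 0 ≤ A) (hr : (A + 1) * r ≤ 1)
    (ha : |a| ≤ A * r ^ 2) (hx : |x| ≤ r) :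
    |(Real.exp (a + x) - 1) ^ 2 - x ^ 2|
      ≤ 2 * (A + 1) ^ 2 * (2 * (A + 1) ^ 2 + 2) * r ^ 3 := by
  have hr₀ : 0 ≤ r := (abs_nonneg x).trans hx
  have hr₁ : r ≤ 1 := by nlinarith
  have hsq : r ^ 2 ≤ r := pow_le_of_le_one hr₀ hr₁ two_ne_zero
  have hax : |a + x| ≤ (A + 1) * r := (abs_add_le _ _).trans (by nlinarith)
  have hexp : |Real.exp (a + x) - 1 - (a + x)| ≤ ((A + 1) * r) ^ 2 :=
    (Real.abs_exp_sub_one_sub_id_le (hax.trans hr)).trans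
      (sq_le_sq.2 (hax.trans (le_abs_self _)))
  have hsub : |Real.exp (a + x) - 1 - x| ≤ 2 * (A + 1) ^ 2 * r ^ 2 :=
    calc |Real.exp (a + x) - 1 - x|
        = |(Real.exp (a + x) - 1 - (a + x)) + a| := by ring_nf
      _ ≤ ((A + 1) * r) ^ 2 + A * r ^ 2 := (abs_add_le _ _).trans (add_le_add hexp ha)
      _ ≤ 2 * (A + 1) ^ 2 * r ^ 2 := by nlinarith [mul_nonneg hA (sq_nonneg r)]
  have hadd : |Real.exp (a + x) - 1 + x| ≤ (2 * (A + 1) ^ 2 + 2) * r :=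
    calc |Real.exp (a + x) - 1 + x|
        = |(Real.exp (a + x) - 1 - x) + 2 * x| := by ring_nf
      _ ≤ 2 * (A + 1) ^ 2 * r ^ 2 + 2 * r := by
          refine (abs_add_le _ _).trans (add_le_add hsub ?_)
          rw [abs_mul, abs_two]
          gcongr
      _ ≤ 2 * (A + 1) ^ 2 * r + 2 * r := by gcongr
      _ = _ := by ring
  calc |(Real.exp (a + x) - 1) ^ 2 - x ^ 2|
      = |Real.exp (a + x) - 1 - x| * |Real.exp (a + x) - 1 + x| := by
        rw [← abs_mul]; ring_nf
    _ ≤ (2 * (A + 1) ^ 2 * r ^ 2) * ((2 * (A + 1) ^ 2 + 2) * r) := by gcongr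
    _ = _ := by ring

lemma abs_inv_sub_inv_le {θ d u v : ℝ} (hθ : 0 < θ) (hu : θ ≤ u) (hd : d ≤ θ / 2)
    (huv : |v - u| ≤ d) : |v⁻¹ - u⁻¹| ≤ 2 * d / θ ^ 2 := by
  have hv : θ / 2 ≤ v := by linarith [(abs_le.1 huv).1]
  have hu₀ : 0 < u := hθ.trans_le hu
  have hv₀ : 0 < v := (half_pos hθ).trans_le hv
  rw [inv_sub_inv hv₀.ne' hu₀.ne', abs_div, abs_of_pos (mul_pos hv₀ hu₀), abs_sub_comm]
  calc |v - u| / (v * u) ≤ d / (θ / 2 * θ) := by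
        have : 0 ≤ d := (abs_nonneg _).trans huv
        gcongr
    _ = 2 * d / θ ^ 2 := by field_simp

/-- The returns `exp (a + x) - 1` of the asset differ from the increments `x` by `O(r²)`, hence
their squares by `O(r³)`. -/
lemma abs_inv_ema_exp_sub_inv_ema_le (hlam : lam ∈ Set.Ioo (0 : ℝ) 1) (hh : 0 < h)
    {A C r θ : ℝ} (hA : 0 ≤ A) (hC : 2 * (A + 1) ^ 2 * (2 * (A + 1) ^ 2 + 2) ≤ C)
    (hr : (A + 1) * r ≤ 1) (hθ : 0 < θ) (hrθ : C * r ^ 3 / h ≤ θ / 2)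
    {a : ℕ → ℝ} {n : ℕ} (hr₀ : 0 ≤ r) (ha : ∀ k < n, |a k| ≤ A * r ^ 2)
    (hx : ∀ k < n, |x k| ≤ r) (hn : θ ≤ ema lam v₀ h x n) :
    |(ema lam v₀ h (fun k ↦ Real.exp (a k + x k) - 1) n)⁻¹ - (ema lam v₀ h x n)⁻¹|
      ≤ 2 * (C * r ^ 3 / h) / θ ^ 2 := by
  have hC₀ : 0 ≤ C := le_trans (by positivity) hC
  refine abs_inv_sub_inv_le hθ hn hrθ (abs_ema_sub_le hlam hh (by positivity) n fun k hk ↦ ?_)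
  rw [div_mul_cancel₀ _ hh.ne']
  exact (abs_exp_sub_one_sq_sub_sq_le hA hr (ha k hk) (hx k hk)).trans (by gcongr)

end Ema

/-! ### Gaussian increments -/

section GaussianEstimates

lemma integral_pow_two_mul_gaussianReal (v : ℝ≥0) (p : ℕ) :
    ∫ y, y ^ (2 * p) ∂(gaussianReal 0 v) = (∫ y, y ^ (2 * p) ∂(gaussianReal 0 1)) * v ^ p := by
  have hmap : (gaussianReal 0 1).map (√(v : ℝ) * ·) = gaussianReal 0 v := by
    rw [gaussianReal_map_const_mul]
    congr 1
    · simp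
    · ext; simp
  rw [← hmap, integral_map (by fun_prop) (by fun_prop), ← integral_mul_const]
  refine integral_congr_ae (ae_of_all _ fun y ↦ ?_)
  simp only [mul_pow, pow_mul √(v : ℝ), Real.sq_sqrt v.coe_nonneg]
  ring

lemma gaussianReal_real_setOf_lt_abs_le (v : ℝ≥0) (p : ℕ) {x : ℝ} (hx : 0 < x) :
    (gaussianReal 0 v).real {y | x < |y|}
      ≤ (∫ y, y ^ (2 * p) ∂(gaussianReal 0 1)) * v ^ p / x ^ (2 * p) := by
  have heven : Even (2 * p) := even_two_mul p
  have hint : Integrable (fun y : ℝ ↦ y ^ (2 * p)) (gaussianReal 0 v) := by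
    have h : MemLp id ((2 * p : ℕ) : ℝ≥0∞) (gaussianReal 0 v) :=
      (IsGaussian.hasGaussianLaw_id (μ := gaussianReal 0 v)).memLp (ENNReal.natCast_ne_top _)
    simpa only [id_eq, Real.norm_eq_abs, heven.pow_abs] using h.integrable_norm_pow'
  rw [le_div_iff₀' (by positivity), ← integral_pow_two_mul_gaussianReal]
  calc x ^ (2 * p) * (gaussianReal 0 v).real {y | x < |y|}
      ≤ x ^ (2 * p) * (gaussianReal 0 v).real {y | x ^ (2 * p) ≤ y ^ (2 * p)} := by
        refine mul_le_mul_of_nonneg_left (measureReal_mono fun y hy ↦ ?_) (by positivity)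
        exact (pow_le_pow_left₀ hx.le (le_of_lt hy) _).trans_eq (heven.pow_abs y)
    _ ≤ ∫ y, y ^ (2 * p) ∂(gaussianReal 0 v) :=
        mul_meas_ge_le_integral_of_nonneg (ae_of_all _ fun y : ℝ ↦ heven.pow_nonneg y) hint _

lemma gaussianPDFReal_le_inv_sqrt (μ : ℝ) (v : ℝ≥0) (y : ℝ) :
    gaussianPDFReal μ v y ≤ (√(2 * Real.pi * v))⁻¹ := by
  refine mul_le_of_le_one_right (by positivity) (Real.exp_le_one_iff.2 ?_)
  exact div_nonpos_of_nonpos_of_nonneg (neg_nonpos.2 (sq_nonneg _)) (by positivity)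

lemma gaussianReal_real_Icc_le {v : ℝ≥0} (hv : v ≠ 0) {x : ℝ} (hx : 0 ≤ x) :
    (gaussianReal 0 v).real (Set.Icc (-x) x) ≤ x / √v := by
  have hv₀ : 0 < (v : ℝ) := by positivity
  have hpdf : gaussianReal 0 v (Set.Icc (-x) x)
      ≤ ENNReal.ofReal ((√(2 * Real.pi * v))⁻¹ * (2 * x)) := by
    rw [gaussianReal_apply _ hv]
    calc ∫⁻ y in Set.Icc (-x) x, gaussianPDF 0 v y
        ≤ ∫⁻ _ in Set.Icc (-x) x, ENNReal.ofReal (√(2 * Real.pi * v))⁻¹ :=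
          setLIntegral_mono measurable_const fun y _ ↦
            ENNReal.ofReal_le_ofReal (gaussianPDFReal_le_inv_sqrt 0 v y)
      _ = ENNReal.ofReal ((√(2 * Real.pi * v))⁻¹ * (2 * x)) := by
          rw [setLIntegral_const, Real.volume_Icc, ← ENNReal.ofReal_mul (by positivity),
            sub_neg_eq_add, ← two_mul]
  have hpi : 2 * √(v : ℝ) ≤ √(2 * Real.pi * v) := by
    refine Real.le_sqrt_of_sq_le ?_
    rw [mul_pow, Real.sq_sqrt hv₀.le]
    nlinarith [Real.pi_gt_three]
  calc (gaussianReal 0 v).real (Set.Icc (-x) x) ≤ (√(2 * Real.pi * v))⁻¹ * (2 * x) :=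
        ENNReal.toReal_le_of_le_ofReal (by positivity) hpdf
    _ ≤ (2 * √(v : ℝ))⁻¹ * (2 * x) := by gcongr
    _ = x / √v := by field_simp

end GaussianEstimates

/-- Independent centred Gaussian random variables `ξ 0, ξ 1, …` with variances in
`[lo * h, hi * h]`, such as the increments of `∫ σ dW` over successive time steps of length `h`. -/
structure IsGaussianIncrements {Ω : Type*} [MeasurableSpace Ω] (P : Measure Ω) (lo hi h : ℝ)
    (ξ : ℕ → Ω → ℝ) : Prop where
  measurable : ∀ k, Measurable (ξ k)
  iIndepFun : iIndepFun ξ P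
  exists_map_eq : ∀ k, ∃ v : ℝ≥0, P.map (ξ k) = gaussianReal 0 v ∧ lo * h ≤ v ∧ v ≤ hi * h

namespace IsGaussianIncrements

variable {Ω : Type*} [MeasurableSpace Ω] {P : Measure Ω} {lo hi h : ℝ} {ξ : ℕ → Ω → ℝ}

lemma measureReal_lt_abs_le (hξ : IsGaussianIncrements P lo hi h ξ) (p k : ℕ) {r : ℝ}
    (hr : 0 < r) :
    P.real {ω | r < |ξ k ω|}
      ≤ (∫ y, y ^ (2 * p) ∂(gaussianReal 0 1)) * (hi * h) ^ p / r ^ (2 * p) := by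
  obtain ⟨v, hv, -, hhi⟩ := hξ.exists_map_eq k
  have hlaw : P.real {ω | r < |ξ k ω|} = (gaussianReal 0 v).real {y | r < |y|} := by
    rw [← hv, map_measureReal_apply (hξ.measurable k)
      (measurableSet_lt measurable_const measurable_abs)]
    rfl
  have hmoment : 0 ≤ ∫ y, y ^ (2 * p) ∂(gaussianReal 0 1) :=
    integral_nonneg fun y ↦ (even_two_mul p).pow_nonneg y
  rw [hlaw]
  refine (gaussianReal_real_setOf_lt_abs_le v p hr).trans ?_
  gcongr

lemma measureReal_preimage_Icc_le (hξ : IsGaussianIncrements P lo hi h ξ) (hlo : 0 < lo)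
    (hh : 0 < h) {x : ℝ} (hx : 0 ≤ x) (k : ℕ) :
    P.real (ξ k ⁻¹' Set.Icc (-x) x) ≤ x / √(lo * h) := by
  obtain ⟨v, hv, hvlo, -⟩ := hξ.exists_map_eq k
  have hv₀ : v ≠ 0 := by
    rintro rfl
    exact (mul_pos hlo hh).not_ge hvlo
  rw [← map_measureReal_apply (hξ.measurable k) measurableSet_Icc, hv]
  refine (gaussianReal_real_Icc_le hv₀ hx).trans ?_
  gcongr

/-- The moving average can only be small if the last `K` increments are all small. -/
lemma measureReal_ema_lt_le (hξ : IsGaussianIncrements P lo hi h ξ) (hlo : 0 < lo) (hh : 0 < h)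
    {lam v₀ θ : ℝ} (hlam : lam ∈ Set.Ioo (0 : ℝ) 1) (hv₀ : 0 < v₀) {K : ℕ}
    (hθ : θ ≤ lam ^ K * v₀) (n : ℕ) :
    P.real {ω | ema lam v₀ h (fun k ↦ ξ k ω) n < θ}
      ≤ √(θ / (lo * (lam ^ K * (1 - lam)))) ^ K := by
  rcases le_or_gt n K with hn | hn
  · have : {ω | ema lam v₀ h (fun k ↦ ξ k ω) n < θ} = ∅ :=
      Set.eq_empty_of_forall_notMem fun ω hω ↦
        (hθ.trans (pow_mul_initial_le_ema hlam hv₀ hh hn)).not_gt hω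
    rw [this, measureReal_empty]
    positivity
  obtain ⟨m, rfl⟩ := Nat.exists_eq_add_of_le' hn.le
  set x := √(θ * h / (lam ^ K * (1 - lam))) with hx
  have hsub : {ω | ema lam v₀ h (fun k ↦ ξ k ω) (m + K) < θ}
      ⊆ ⋂ k ∈ Finset.Ico m (m + K), ξ k ⁻¹' Set.Icc (-x) x := fun ω hω ↦
    Set.mem_iInter₂.2 fun k hk ↦ abs_le.1 (abs_le_sqrt_of_ema_le (x := fun k ↦ ξ k ω) hlam hv₀ hh
      (Finset.mem_Ico.1 hk).1 (Finset.mem_Ico.1 hk).2 (le_of_lt hω))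
  have := hξ.iIndepFun.isProbabilityMeasure
  calc P.real {ω | ema lam v₀ h (fun k ↦ ξ k ω) (m + K) < θ}
      ≤ P.real (⋂ k ∈ Finset.Ico m (m + K), ξ k ⁻¹' Set.Icc (-x) x) := measureReal_mono hsub
    _ = ∏ k ∈ Finset.Ico m (m + K), P.real (ξ k ⁻¹' Set.Icc (-x) x) := by
        simp only [measureReal_def, ← ENNReal.toReal_prod]
        rw [hξ.iIndepFun.measure_inter_preimage_eq_mul _ fun _ _ ↦ measurableSet_Icc]
    _ ≤ ∏ _k ∈ Finset.Ico m (m + K), x / √(lo * h) :=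
        Finset.prod_le_prod (fun _ _ ↦ measureReal_nonneg) fun k _ ↦
          hξ.measureReal_preimage_Icc_le hlo hh (Real.sqrt_nonneg _) k
    _ = √(θ / (lo * (lam ^ K * (1 - lam)))) ^ K := by
        rw [Finset.prod_const, Nat.card_Ico, Nat.add_sub_cancel_left, hx,
          ← Real.sqrt_div' _ (by positivity)]
        congr 2
        field_simp

lemma measureReal_exists_lt_abs_or_ema_lt_le (hξ : IsGaussianIncrements P lo hi h ξ) (hlo : 0 < lo)
    (hh : 0 < h) {lam v₀ θ r : ℝ} (hlam : lam ∈ Set.Ioo (0 : ℝ) 1) (hv₀ : 0 < v₀) (p : ℕ) {K : ℕ}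
    (hθ : θ ≤ lam ^ K * v₀) (hr : 0 < r) (N : ℕ) :
    P.real {ω | ∃ k < N, r < |ξ k ω| ∨ ema lam v₀ h (fun k ↦ ξ k ω) k < θ}
      ≤ N * ((∫ y, y ^ (2 * p) ∂(gaussianReal 0 1)) * (hi * h) ^ p / r ^ (2 * p)
        + √(θ / (lo * (lam ^ K * (1 - lam)))) ^ K) := by
  have := hξ.iIndepFun.isProbabilityMeasure
  have hunion : {ω | ∃ k < N, r < |ξ k ω| ∨ ema lam v₀ h (fun k ↦ ξ k ω) k < θ}
      = ⋃ k ∈ Finset.range N, ({ω | r < |ξ k ω|} ∪ {ω | ema lam v₀ h (fun k ↦ ξ k ω) k < θ}) := by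
    ext ω
    simp
  rw [hunion]
  refine (measureReal_biUnion_finset_le _ _).trans ((Finset.sum_le_card_nsmul _ _ _ fun k _ ↦
    (measureReal_union_le _ _).trans (add_le_add (hξ.measureReal_lt_abs_le p k hr)
      (hξ.measureReal_ema_lt_le hlo hh hlam hv₀ hθ k))).trans_eq ?_)
  rw [Finset.card_range, nsmul_eq_mul]

end IsGaussianIncrements

/-! ### Martingale transforms -/

section MartingaleTransform

variable {Ω : Type*} {mΩ : MeasurableSpace Ω} {P : Measure Ω} {ℱ : Filtration ℕ mΩ}
  {ξ δ : ℕ → Ω → ℝ} {ε s : ℝ}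

lemma measurable_sum_mul_of_adapted (hξ : ∀ k, Measurable[ℱ (k + 1)] (ξ k))
    (hδ : ∀ k, Measurable[ℱ k] (δ k)) (n : ℕ) :
    Measurable[ℱ n] fun ω ↦ ∑ k ∈ Finset.range n, δ k ω * ξ k ω := by
  refine Finset.measurable_fun_sum _ fun k hk ↦ ?_
  have hkn : k < n := Finset.mem_range.1 hk
  exact ((hδ k).mono (ℱ.mono hkn.le) le_rfl).mul ((hξ k).mono (ℱ.mono hkn) le_rfl)

lemma memLp_mul_of_abs_le {X Y : Ω → ℝ} {p : ℝ≥0∞} (hX : AEStronglyMeasurable X P)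
    (hε : ∀ ω, |X ω| ≤ ε) (hY : MemLp Y p P) : MemLp (fun ω ↦ X ω * Y ω) p P :=
  hY.of_le_mul (c := ε) (hX.mul hY.aestronglyMeasurable) (ae_of_all _ fun ω ↦ by
    rw [norm_mul]
    exact mul_le_mul_of_nonneg_right (hε ω) (norm_nonneg _))

lemma integral_sq_mul_le_of_abs_le {X Y : Ω → ℝ} (hε : ∀ ω, |X ω| ≤ ε) (hY : MemLp Y 2 P) :
    ∫ ω, (X ω * Y ω) ^ 2 ∂P ≤ ε ^ 2 * ∫ ω, Y ω ^ 2 ∂P := by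
  rw [← integral_const_mul]
  refine integral_mono_of_nonneg (ae_of_all _ fun ω ↦ sq_nonneg _)
    (hY.integrable_sq.const_mul _) (ae_of_all _ fun ω ↦ ?_)
  simp only [mul_pow]
  exact mul_le_mul_of_nonneg_right (sq_le_sq.2 ((hε ω).trans (le_abs_self ε))) (sq_nonneg _)

lemma integral_add_sq_of_integral_mul_eq_zero {X Y : Ω → ℝ} (hX : MemLp X 2 P) (hY : MemLp Y 2 P)
    (hXY : ∫ ω, X ω * Y ω ∂P = 0) :
    ∫ ω, (X ω + Y ω) ^ 2 ∂P = ∫ ω, X ω ^ 2 ∂P + ∫ ω, Y ω ^ 2 ∂P := by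
  have hsum : Integrable (fun ω ↦ X ω ^ 2 + Y ω ^ 2) P := hX.integrable_sq.add hY.integrable_sq
  have hprod : Integrable (fun ω ↦ 2 * (X ω * Y ω)) P := (hX.integrable_mul hY).const_mul 2
  calc ∫ ω, (X ω + Y ω) ^ 2 ∂P = ∫ ω, (X ω ^ 2 + Y ω ^ 2) + 2 * (X ω * Y ω) ∂P := by
        congr with ω
        ring
    _ = ∫ ω, X ω ^ 2 ∂P + ∫ ω, Y ω ^ 2 ∂P := by
        rw [integral_add hsum hprod, integral_add hX.integrable_sq hY.integrable_sq,
          integral_const_mul, hXY, mul_zero, add_zero]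

lemma integral_sq_sum_mul_le_of_adapted (hξ : ∀ k, Measurable[ℱ (k + 1)] (ξ k))
    (hδ : ∀ k, Measurable[ℱ k] (δ k))
    (hind : ∀ k, Indep (ℱ k) (MeasurableSpace.comap (ξ k) inferInstance) P)
    (hξL : ∀ k, MemLp (ξ k) 2 P) (hξ₀ : ∀ k, ∫ ω, ξ k ω ∂P = 0)
    (hs : ∀ k, ∫ ω, ξ k ω ^ 2 ∂P ≤ s) (hε : ∀ k ω, |δ k ω| ≤ ε) (n : ℕ) :
    ∫ ω, (∑ k ∈ Finset.range n, δ k ω * ξ k ω) ^ 2 ∂P ≤ n * (ε ^ 2 * s) := by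
  have hterm (k : ℕ) : MemLp (fun ω ↦ δ k ω * ξ k ω) 2 P :=
    memLp_mul_of_abs_le ((hδ k).mono (ℱ.le k) le_rfl).aestronglyMeasurable (hε k) (hξL k)
  induction n with
  | zero => simp
  | succ n ih =>
    have hpast : Measurable[ℱ n] fun ω ↦ (∑ k ∈ Finset.range n, δ k ω * ξ k ω) * δ n ω :=
      (measurable_sum_mul_of_adapted hξ hδ n).mul (hδ n)
    have hcross : ∫ ω, (∑ k ∈ Finset.range n, δ k ω * ξ k ω) * (δ n ω * ξ n ω) ∂P = 0 := by
      have hindep := (IndepFun_iff_Indep _ _ _).2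
        (indep_of_indep_of_le_left (hind n) hpast.comap_le)
      simp only [← mul_assoc]
      rw [hindep.integral_fun_mul_eq_mul_integral (hpast.mono (ℱ.le n) le_rfl).aestronglyMeasurable
        (hξL n).aestronglyMeasurable, hξ₀, mul_zero]
    simp only [Finset.sum_range_succ]
    rw [integral_add_sq_of_integral_mul_eq_zero (memLp_finsetSum _ fun k _ ↦ hterm k) (hterm n)
      hcross, Nat.cast_succ, add_one_mul]
    gcongr
    exact (integral_sq_mul_le_of_abs_le (hε n) (hξL n)).trans (by gcongr; exact hs n)

lemma measureReal_le_abs_le {X : Ω → ℝ} (hX : MemLp X 2 P) {c : ℝ} (hc : 0 < c) :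
    P.real {ω | c ≤ |X ω|} ≤ (∫ ω, X ω ^ 2 ∂P) / c ^ 2 := by
  rw [le_div_iff₀' (by positivity)]
  refine le_of_eq_of_le ?_ (mul_meas_ge_le_integral_of_nonneg
    (ae_of_all _ fun ω ↦ sq_nonneg (X ω)) hX.integrable_sq (c ^ 2))
  simp only [sq_le_sq, abs_of_pos hc]

/-- The `σ`-algebra generated by `ξ 0, …, ξ (n - 1)`. Unlike in the natural filtration of `ξ`, the
variable `ξ n` itself is left out, so that predictable weights of `ξ n` are measurable. -/
def pastFiltration (ξ : ℕ → Ω → ℝ) (hξ : ∀ k, Measurable (ξ k)) : Filtration ℕ mΩ where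
  seq n := ⨆ k ∈ Set.Iio n, MeasurableSpace.comap (ξ k) inferInstance
  mono' _ _ h := biSup_mono fun _ hk ↦ lt_of_lt_of_le hk h
  le' _ := iSup₂_le fun k _ ↦ (hξ k).comap_le

lemma measurable_pastFiltration (hξ : ∀ k, Measurable (ξ k)) {k n : ℕ} (hk : k < n) :
    Measurable[pastFiltration ξ hξ n] (ξ k) :=
  measurable_iff_comap_le.2
    (le_iSup₂_of_le (f := fun k (_ : k ∈ Set.Iio n) ↦ MeasurableSpace.comap (ξ k) inferInstance)
      k hk le_rfl)

lemma indep_pastFiltration (hξ : ∀ k, Measurable (ξ k)) (hind : iIndepFun ξ P) (n : ℕ) :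
    Indep (pastFiltration ξ hξ n) (MeasurableSpace.comap (ξ n) inferInstance) P := by
  have h := indep_iSup_of_disjoint (fun k ↦ (hξ k).comap_le) hind.iIndep
    (S := Set.Iio n) (T := {n}) (by simp)
  simp only [Set.mem_singleton_iff, iSup_iSup_eq_left] at h
  exact h

end MartingaleTransform

namespace IsGaussianIncrements

variable {Ω : Type*} [MeasurableSpace Ω] {P : Measure Ω} {lo hi h : ℝ} {ξ : ℕ → Ω → ℝ}

lemma memLp_two (hξ : IsGaussianIncrements P lo hi h ξ) (k : ℕ) : MemLp (ξ k) 2 P := by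
  obtain ⟨v, hv, -⟩ := hξ.exists_map_eq k
  exact HasGaussianLaw.memLp_two (HasLaw.hasGaussianLaw ⟨(hξ.measurable k).aemeasurable, hv⟩)

lemma integral_eq_zero (hξ : IsGaussianIncrements P lo hi h ξ) (k : ℕ) : ∫ ω, ξ k ω ∂P = 0 := by
  obtain ⟨v, hv, -⟩ := hξ.exists_map_eq k
  rw [HasLaw.integral_eq ⟨(hξ.measurable k).aemeasurable, hv⟩, integral_id_gaussianReal]

lemma integral_sq_le (hξ : IsGaussianIncrements P lo hi h ξ) (k : ℕ) :
    ∫ ω, ξ k ω ^ 2 ∂P ≤ hi * h := by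
  obtain ⟨v, hv, -, hhi⟩ := hξ.exists_map_eq k
  rw [← variance_of_integral_eq_zero (hξ.measurable k).aemeasurable (hξ.integral_eq_zero k),
    HasLaw.variance_eq ⟨(hξ.measurable k).aemeasurable, hv⟩, variance_id_gaussianReal]
  exact hhi

lemma measureReal_le_abs_sum_mul_le (hξ : IsGaussianIncrements P lo hi h ξ) {δ : ℕ → Ω → ℝ}
    (hδ : ∀ k, Measurable[pastFiltration ξ hξ.measurable k] (δ k)) {ε : ℝ}
    (hε : ∀ k ω, |δ k ω| ≤ ε) {c : ℝ} (hc : 0 < c) (n : ℕ) :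
    P.real {ω | c ≤ |∑ k ∈ Finset.range n, δ k ω * ξ k ω|} ≤ n * (ε ^ 2 * (hi * h)) / c ^ 2 := by
  refine (measureReal_le_abs_le (memLp_finsetSum _ fun k _ ↦ memLp_mul_of_abs_le
    ((hδ k).mono (Filtration.le _ k) le_rfl).aestronglyMeasurable (hε k)
    (hξ.memLp_two k)) hc).trans ?_
  gcongr
  exact integral_sq_sum_mul_le_of_adapted
    (fun k ↦ measurable_pastFiltration hξ.measurable k.lt_succ_self) hδ
    (indep_pastFiltration hξ.measurable hξ.iIndepFun) hξ.memLp_two hξ.integral_eq_zero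
    hξ.integral_sq_le hε n

/-- Truncating the weights at level `η` keeps them predictable, and changes the sum only where some
weight exceeds `η`. -/
lemma measureReal_le_abs_sum_mul_le_add (hξ : IsGaussianIncrements P lo hi h ξ) {δ : ℕ → Ω → ℝ}
    (hδ : ∀ k, Measurable[pastFiltration ξ hξ.measurable k] (δ k)) {c η : ℝ} (hc : 0 < c)
    (hη : 0 ≤ η) (n : ℕ) :
    P.real {ω | c ≤ |∑ k ∈ Finset.range n, δ k ω * ξ k ω|}
      ≤ P.real {ω | ∃ k < n, η < |δ k ω|} + n * (η ^ 2 * (hi * h)) / c ^ 2 := by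
  have := hξ.iIndepFun.isProbabilityMeasure
  have htrunc (k : ℕ) (ω : Ω) : |max (-η) (min η (δ k ω))| ≤ η :=
    abs_le.2 ⟨le_max_left _ _, max_le (by linarith) (min_le_left _ _)⟩
  have hmeas (k : ℕ) :
      Measurable[pastFiltration ξ hξ.measurable k] fun ω ↦ max (-η) (min η (δ k ω)) :=
    measurable_const.max (measurable_const.min (hδ k))
  refine (measureReal_mono fun ω hω ↦ ?_).trans ((measureReal_union_le
    {ω | ∃ k < n, η < |δ k ω|} _).trans
      (add_le_add_right (hξ.measureReal_le_abs_sum_mul_le hmeas htrunc hc n) _))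
  refine or_iff_not_imp_left.2 fun hsmall ↦
    le_of_le_of_eq (b := |∑ k ∈ Finset.range n, δ k ω * ξ k ω|) hω ?_
  have hle (k : ℕ) (hk : k < n) : |δ k ω| ≤ η := not_lt.1 fun hlt ↦ hsmall ⟨k, hk, hlt⟩
  congr 1
  refine Finset.sum_congr rfl fun k hk ↦ ?_
  obtain ⟨hlo, hhi⟩ := abs_le.1 (hle k (Finset.mem_range.1 hk))
  rw [min_eq_right hhi, max_eq_right hlo]

end IsGaussianIncrements

/-! ### Uniform convergence in probability along the rows of an array -/

section Rows

variable {Ω : Type*} [MeasurableSpace Ω] {P : Measure Ω}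

lemma abs_sqrt_sub_sqrt_le (a b : ℝ) : |√a - √b| ≤ √|a - b| := by
  refine Real.abs_le_sqrt ?_
  have hsq (x : ℝ) : √x ^ 2 = max x 0 := by
    rcases le_total 0 x with h | h
    · rw [Real.sq_sqrt h, max_eq_left h]
    · rw [Real.sqrt_eq_zero_of_nonpos h, max_eq_right h, zero_pow two_ne_zero]
  have ha := Real.sqrt_nonneg a
  have hb := Real.sqrt_nonneg b
  calc (√a - √b) ^ 2 = |√a - √b| * |√a - √b| := by rw [abs_mul_abs_self, sq]
    _ ≤ (√a + √b) * |√a - √b| := by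
        gcongr
        exact abs_le.2 ⟨by linarith, by linarith⟩
    _ = |√a ^ 2 - √b ^ 2| := by rw [sq_sub_sq, abs_mul, abs_of_nonneg (add_nonneg ha hb)]
    _ ≤ |a - b| := by
        rw [hsq, hsq]
        exact abs_max_sub_max_le_abs a b 0

lemma tendstoInMeasure_zero_add [IsFiniteMeasure P] {Y Z : ℕ → Ω → ℝ}
    (hY : TendstoInMeasure P Y atTop 0) (hZ : TendstoInMeasure P Z atTop 0) :
    TendstoInMeasure P (Y + Z) atTop 0 := by
  rw [tendstoInMeasure_iff_measureReal_norm] at *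
  intro ε hε
  have h := (hY (ε / 2) (half_pos hε)).add (hZ (ε / 2) (half_pos hε))
  rw [add_zero] at h
  refine squeeze_zero (fun _ ↦ measureReal_nonneg) (fun N ↦ ?_) h
  refine (measureReal_mono fun ω hω ↦ ?_).trans (measureReal_union_le _ _)
  simp only [Pi.zero_apply, sub_zero, Set.mem_ofPred_eq, Set.mem_union, Pi.add_apply] at hω ⊢
  by_contra! hlt
  linarith [norm_add_le (Y N ω) (Z N ω), hlt.1, hlt.2]

lemma tendstoInMeasure_zero_const_smul [IsFiniteMeasure P] {Y : ℕ → Ω → ℝ}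
    (hY : TendstoInMeasure P Y atTop 0) (c : ℝ) : TendstoInMeasure P (c • Y) atTop 0 := by
  rw [tendstoInMeasure_iff_measureReal_norm] at *
  intro ε hε
  refine squeeze_zero (fun _ ↦ measureReal_nonneg) (fun N ↦ measureReal_mono fun ω hω ↦ ?_)
    (hY (ε / (‖c‖ + 1)) (by positivity))
  simp only [Pi.zero_apply, sub_zero, Set.mem_ofPred_eq, Pi.smul_apply, norm_smul] at hω ⊢
  rw [div_le_iff₀ (by positivity)]
  nlinarith [norm_nonneg (Y N ω)]

/-- The maxima `max_{k < N} |D N k|` over the rows of the array `D` tend to `0` in probability. -/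
def RowsTendstoZeroInMeasure (P : Measure Ω) (D : ℕ → ℕ → Ω → ℝ) : Prop :=
  ∀ ε > 0, Tendsto (fun N ↦ P.real {ω | ∃ k < N, ε < |D N k ω|}) atTop (𝓝 0)

namespace RowsTendstoZeroInMeasure

variable {D D' : ℕ → ℕ → Ω → ℝ}

lemma congr_ae (hD : RowsTendstoZeroInMeasure P D) (h : ∀ N, ∀ k < N, D N k =ᵐ[P] D' N k) :
    RowsTendstoZeroInMeasure P D' := by
  intro ε hε
  refine (hD ε hε).congr fun N ↦ measureReal_congr (eventuallyEq_set.2 ?_)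
  have hrow : ∀ᵐ ω ∂P, ∀ k < N, D N k ω = D' N k ω :=
    ae_all_iff.2 fun k ↦ eventually_imp_distrib_left.2 (h N k)
  filter_upwards [hrow] with ω hω
  exact exists_congr fun k ↦ and_congr_right fun hk ↦ by rw [hω k hk]

variable [IsFiniteMeasure P]

lemma of_forall_exists_abs_le (hD : RowsTendstoZeroInMeasure P D)
    (h : ∀ ε > 0, ∃ η > 0, ∀ N k ω, |D N k ω| ≤ η → |D' N k ω| ≤ ε) :
    RowsTendstoZeroInMeasure P D' := by
  intro ε hε
  obtain ⟨η, hη, hle⟩ := h ε hε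
  refine squeeze_zero (fun _ ↦ measureReal_nonneg) (fun N ↦ measureReal_mono ?_) (hD η hη)
  rintro ω ⟨k, hk, hlt⟩
  exact ⟨k, hk, lt_of_not_ge fun hge ↦ (hle N k ω hge).not_gt hlt⟩

lemma const_mul (hD : RowsTendstoZeroInMeasure P D) (c : ℝ) :
    RowsTendstoZeroInMeasure P fun N k ω ↦ c * D N k ω := by
  refine hD.of_forall_exists_abs_le fun ε hε ↦ ⟨ε / (|c| + 1), by positivity, fun N k ω h ↦ ?_⟩
  rw [le_div_iff₀ (by positivity)] at h
  rw [abs_mul]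
  linarith [abs_nonneg (D N k ω)]

lemma sqrt_sub_sqrt {V U : ℕ → ℕ → Ω → ℝ}
    (h : RowsTendstoZeroInMeasure P fun N k ω ↦ V N k ω - U N k ω) :
    RowsTendstoZeroInMeasure P fun N k ω ↦ √(V N k ω) - √(U N k ω) :=
  h.of_forall_exists_abs_le fun ε hε ↦ ⟨ε ^ 2, by positivity, fun N k ω h ↦
    (abs_sqrt_sub_sqrt_le _ _).trans (Real.sqrt_le_iff.2 ⟨hε.le, h⟩)⟩

lemma tendstoInMeasure_sum_mul (hD : RowsTendstoZeroInMeasure P D) {b : ℕ → ℕ → ℝ} {B : ℝ}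
    (hb : ∀ N, ∑ k ∈ Finset.range N, |b N k| ≤ B) :
    TendstoInMeasure P (fun N ω ↦ ∑ k ∈ Finset.range N, D N k ω * b N k) atTop 0 := by
  rw [tendstoInMeasure_iff_measureReal_norm]
  intro ε hε
  have hB : 0 ≤ B := by simpa using hb 0
  refine squeeze_zero (fun _ ↦ measureReal_nonneg) (fun N ↦ measureReal_mono fun ω hω ↦ ?_)
    (hD (ε / (B + 1)) (by positivity))
  simp only [Pi.zero_apply, sub_zero, Set.mem_ofPred_eq, Real.norm_eq_abs] at hω ⊢
  by_contra! hle
  refine hω.not_gt ?_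
  calc |∑ k ∈ Finset.range N, D N k ω * b N k|
      ≤ ∑ k ∈ Finset.range N, ε / (B + 1) * |b N k| :=
        Finset.abs_sum_le_sum_abs _ _ |>.trans (Finset.sum_le_sum fun k hk ↦ by
          rw [abs_mul]
          exact mul_le_mul_of_nonneg_right (hle k (Finset.mem_range.1 hk)) (abs_nonneg _))
    _ ≤ ε / (B + 1) * B := by
        rw [← Finset.mul_sum]
        gcongr
        exact hb N
    _ < ε := by
        rw [div_mul_eq_mul_div, div_lt_iff₀ (by positivity)]
        linarith

lemma tendstoInMeasure_sum_mul_gaussian {lo hi T : ℝ} {ξ : ℕ → ℕ → Ω → ℝ}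
    (hD : RowsTendstoZeroInMeasure P D) (hξ : ∀ N : ℕ, IsGaussianIncrements P lo hi (T / N) (ξ N))
    (hDm : ∀ N k, Measurable[pastFiltration (ξ N) (hξ N).measurable k] (D N k)) :
    TendstoInMeasure P (fun N ω ↦ ∑ k ∈ Finset.range N, D N k ω * ξ N k ω) atTop 0 := by
  rw [tendstoInMeasure_iff_measureReal_norm]
  intro c hc
  refine tendsto_order.2 ⟨fun κ hκ ↦ Eventually.of_forall fun _ ↦ hκ.trans_le measureReal_nonneg,
    fun κ hκ ↦ ?_⟩
  have hsmall : Tendsto (fun η : ℝ ↦ η ^ 2 * (hi * T) / c ^ 2) (𝓝[>] 0) (𝓝 0) := by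
    refine (Continuous.tendsto' ?_ 0 0 (by simp)).mono_left nhdsWithin_le_nhds
    fun_prop
  obtain ⟨η, hηκ, hη⟩ :=
    ((hsmall.eventually (gt_mem_nhds (half_pos hκ))).and self_mem_nhdsWithin).exists
  filter_upwards [(hD η hη).eventually (gt_mem_nhds (half_pos hκ)), eventually_ne_atTop 0]
    with N hN hN₀
  have hvar : N * (η ^ 2 * (hi * (T / N))) / c ^ 2 = η ^ 2 * (hi * T) / c ^ 2 := by
    have : (N : ℝ) ≠ 0 := Nat.cast_ne_zero.2 hN₀
    field_simp
  have hbound := (hξ N).measureReal_le_abs_sum_mul_le_add (hDm N) hc (le_of_lt hη) N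
  simp only [Pi.zero_apply, sub_zero, Real.norm_eq_abs]
  linarith

end RowsTendstoZeroInMeasure

end Rows

/-! ### Comparison of the moving averages -/

section InverseEma

variable {Ω : Type*} [MeasurableSpace Ω] {P : Measure Ω} {lam v₀ lo hi A C : ℝ}

/-- The powers of `g = h ^ (1 / 12)` are such that, outside an event of probability
`O(N * h * g ^ 2)`, all increments are at most `g ^ 5` and all moving averages are at least `g`. -/
lemma IsGaussianIncrements.measureReal_exists_lt_abs_inv_ema_sub_le {h : ℝ} {ξ : ℕ → Ω → ℝ}
    (hξ : IsGaussianIncrements P lo hi h ξ) (hlo : 0 < lo) (hlam : lam ∈ Set.Ioo (0 : ℝ) 1)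
    (hv₀ : 0 < v₀) (hA : 0 ≤ A) (hC : 2 * (A + 1) ^ 2 * (2 * (A + 1) ^ 2 + 2) ≤ C) {g : ℝ}
    (hg : 0 < g) (hgh : g ^ 12 = h) (hg₁ : g ≤ 1) (hgA : (A + 1) * g ≤ 1) (hgC : C * g ≤ 1 / 2)
    (hgv₀ : g ≤ lam ^ 28 * v₀) {a : ℕ → ℝ} {N : ℕ} (ha : ∀ k < N, |a k| ≤ A * h) :
    P.real {ω | ∃ k < N, 2 * C * g < |(ema lam v₀ h (fun j ↦ Real.exp (a j + ξ j ω) - 1) k)⁻¹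
        - (ema lam v₀ h (fun j ↦ ξ j ω) k)⁻¹|}
      ≤ ((∫ y, y ^ 14 ∂(gaussianReal 0 1)) * hi ^ 7 + (lo * (lam ^ 28 * (1 - lam)))⁻¹ ^ 14)
        * (N * h) * g ^ 2 := by
  have := hξ.iIndepFun.isProbabilityMeasure
  have hlam₁ : 0 < 1 - lam := sub_pos.2 hlam.2
  have hlam₀ := hlam.1
  have hh : 0 < h := hgh ▸ pow_pos hg 12
  have hC₀ : 0 ≤ C := le_trans (by positivity) hC
  have hgood (ω : Ω) (hω : ∀ k < N, |ξ k ω| ≤ g ^ 5 ∧ g ≤ ema lam v₀ h (fun k ↦ ξ k ω) k) (k : ℕ)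
      (hk : k < N) : |(ema lam v₀ h (fun j ↦ Real.exp (a j + ξ j ω) - 1) k)⁻¹
        - (ema lam v₀ h (fun j ↦ ξ j ω) k)⁻¹| ≤ 2 * C * g := by
    have hgap : C * (g ^ 5) ^ 3 / h = C * g ^ 3 := by
      rw [← hgh]
      field_simp
    refine (abs_inv_ema_exp_sub_inv_ema_le hlam hh hA hC (r := g ^ 5) ?_ hg ?_ (by positivity)
      (fun j hj ↦ (ha j (hj.trans hk)).trans ?_) (fun j hj ↦ (hω j (hj.trans hk)).1)
      (hω k hk).2).trans_eq ?_
    · refine le_trans ?_ hgA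
      gcongr
      exact pow_le_of_le_one hg.le hg₁ (by norm_num)
    · rw [hgap]
      nlinarith [mul_le_mul_of_nonneg_left hg₁ hg.le, mul_nonneg hC₀ hg.le]
    · rw [← hgh, ← pow_mul]
      exact mul_le_mul_of_nonneg_left (pow_le_pow_of_le_one hg.le hg₁ (by norm_num)) hA
    · rw [hgap]
      field_simp
  refine (measureReal_mono ?_).trans
    ((hξ.measureReal_exists_lt_abs_or_ema_lt_le hlo hh hlam hv₀ 7 hgv₀ (pow_pos hg 5)
      N).trans_eq ?_)
  · rintro ω ⟨k, hk, hlt⟩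
    by_contra hnot
    simp only [Set.mem_ofPred_eq, not_exists, not_and, not_or, not_lt] at hnot
    exact (hgood ω hnot k hk).not_gt hlt
  · rw [show (28 : ℕ) = 2 * 14 from rfl, pow_mul √_, Real.sq_sqrt (by positivity), ← hgh]
    field_simp
    ring

lemma rowsTendstoZeroInMeasure_inv_ema_sub [IsFiniteMeasure P] {T : ℝ} (hT : 0 < T)
    {ξ : ℕ → ℕ → Ω → ℝ} (hξ : ∀ N : ℕ, IsGaussianIncrements P lo hi (T / N) (ξ N)) (hlo : 0 < lo)
    (hlam : lam ∈ Set.Ioo (0 : ℝ) 1) (hv₀ : 0 < v₀) (hA : 0 ≤ A) {a : ℕ → ℕ → ℝ}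
    (ha : ∀ N : ℕ, ∀ k < N, |a N k| ≤ A * (T / N)) :
    RowsTendstoZeroInMeasure P fun N k ω ↦
      (ema lam v₀ (T / N) (fun j ↦ Real.exp (a N j + ξ N j ω) - 1) k)⁻¹
        - (ema lam v₀ (T / N) (fun j ↦ ξ N j ω) k)⁻¹ := by
  intro ε hε
  set C := 2 * (A + 1) ^ 2 * (2 * (A + 1) ^ 2 + 2)
  set K := ((∫ y, y ^ 14 ∂(gaussianReal 0 1)) * hi ^ 7
    + (lo * (lam ^ 28 * (1 - lam)))⁻¹ ^ 14) * T
  set g : ℕ → ℝ := fun N ↦ (T / N) ^ (1 / 12 : ℝ)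
  have hg₀ : Tendsto g atTop (𝓝 0) := by
    have := (tendsto_const_div_atTop_nhds_zero_nat T).rpow_const (p := 1 / 12) (by norm_num)
    rwa [Real.zero_rpow (by norm_num)] at this
  have hmul (c : ℝ) {b : ℝ} (hb : 0 < b) : ∀ᶠ N in atTop, c * g N ≤ b :=
    ((hg₀.const_mul c).eventually_le_const (by rwa [mul_zero]))
  have hlimit : Tendsto (fun N ↦ K * g N ^ 2) atTop (𝓝 0) := by simpa using (hg₀.pow 2).const_mul K
  refine squeeze_zero' (Eventually.of_forall fun _ ↦ measureReal_nonneg) ?_ hlimit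
  filter_upwards [eventually_ne_atTop 0, hmul 1 one_pos, hmul (A + 1) one_pos, hmul C one_half_pos,
    hmul 1 (mul_pos (pow_pos hlam.1 28) hv₀), hmul (2 * C) hε] with N hN hg₁ hgA hgC hgv₀ hgε
  rw [one_mul] at hg₁ hgv₀
  have hN₀ : (0 : ℝ) < N := by positivity
  have hgpow : g N ^ 12 = T / N := by
    rw [← Real.rpow_mul_natCast (by positivity)]
    norm_num
  have hbound := (hξ N).measureReal_exists_lt_abs_inv_ema_sub_le hlo hlam hv₀ hA le_rfl
    (g := g N) (by positivity) hgpow hg₁ hgA hgC hgv₀ (ha N)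
  rw [mul_div_cancel₀ _ hN₀.ne'] at hbound
  refine (measureReal_mono ?_).trans hbound
  rintro ω ⟨k, hk, hlt⟩
  exact ⟨k, hk, hgε.trans_lt hlt⟩

end InverseEma

variable {Ω : Type*} [MeasurableSpace Ω] {P : Measure Ω} {W : ℝ≥0 → Ω → ℝ}

/-! ### Increments of the Wiener integral of a bounded function -/

lemma exists_measurable_ae_eq_abs_mem_Icc {α : Type*} [MeasurableSpace α] {μ : Measure α}
    {f : α → ℝ} {lo : ℝ} (hf : MemLp f ∞ μ) (hlo : ∀ᵐ x ∂μ, lo ≤ |f x|) :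
    ∃ hi, ∃ g : α → ℝ, Measurable g ∧ (∀ x, |g x| ∈ Set.Icc lo hi) ∧ f =ᵐ[μ] g := by
  set hi := max |lo| (lpNorm f ∞ μ)
  have hhi : 0 ≤ hi := (abs_nonneg lo).trans (le_max_left _ _)
  have hmem : ∀ᵐ x ∂μ, f x ∈ {y | |y| ∈ Set.Icc lo hi} := by
    filter_upwards [hlo, ae_le_lpNorm_exponent_top hf] with x hx₁ hx₂
    exact ⟨hx₁, hx₂.trans (le_max_right _ _)⟩
  obtain ⟨g, hg, hrange, hfg⟩ := hf.aestronglyMeasurable.aemeasurable.exists_ae_eq_range_subset hmem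
    ⟨hi, by
      rw [Set.mem_ofPred_eq, abs_of_nonneg hhi]
      exact ⟨(le_abs_self lo).trans (le_max_left _ _), le_rfl⟩⟩
  exact ⟨hi, g, hg, fun x ↦ hrange (Set.mem_range_self x), hfg⟩

lemma integral_indicator_Ioc_sq_mem_Icc {s : ℝ → ℝ} {lo hi a b : ℝ} (hlo : 0 ≤ lo) (hab : a ≤ b)
    (hs : MemLp s 2 (volume.restrict (Set.Ioc a b))) (hbd : ∀ x, |s x| ∈ Set.Icc lo hi) :
    ∫ x, (Set.Ioc a b).indicator s x ^ 2 ∈ Set.Icc (lo ^ 2 * (b - a)) (hi ^ 2 * (b - a)) := by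
  have hsq : (fun x ↦ (Set.Ioc a b).indicator s x ^ 2)
      = (Set.Ioc a b).indicator fun x ↦ s x ^ 2 := by
    ext x
    by_cases hx : x ∈ Set.Ioc a b <;> simp [hx]
  have hconst (c : ℝ) : ∫ _ in Set.Ioc a b, c ^ 2 = c ^ 2 * (b - a) := by simp [hab, mul_comm]
  rw [hsq, integral_indicator measurableSet_Ioc, ← hconst lo, ← hconst hi]
  constructor
  · refine integral_mono (integrable_const _) hs.integrable_sq fun x ↦ ?_
    exact (pow_le_pow_left₀ hlo (hbd x).1 2).trans_eq (sq_abs _)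
  · refine integral_mono hs.integrable_sq (integrable_const _) fun x ↦ ?_
    exact (sq_abs _).symm.trans_le (pow_le_pow_left₀ (abs_nonneg _) (hbd x).2 2)

lemma exists_isGaussianIncrements (hW : IsPreBrownianReal W P) {s : ℝ → ℝ} {lo hi h : ℝ}
    (hs : Measurable s) (hlo : 0 ≤ lo) (hbd : ∀ x, |s x| ∈ Set.Icc lo hi) (hh : 0 ≤ h) :
    ∃ ξ : ℕ → Ω → ℝ, IsGaussianIncrements P (lo ^ 2) (hi ^ 2) h ξ ∧
      ∀ k : ℕ, wienerIntegral W P s (k * h) ((k + 1 : ℕ) * h) =ᵐ[P] ξ k := by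
  set window : ℕ → Set ℝ := fun k ↦ Set.Ioc (k * h) ((k + 1 : ℕ) * h)
  have hmono : Monotone fun k : ℕ ↦ k * h := fun i j hij ↦
    mul_le_mul_of_nonneg_right (Nat.cast_le.2 hij) hh
  have hsL (k : ℕ) : MemLp s 2 (volume.restrict (window k)) :=
    MemLp.of_bound hs.aestronglyMeasurable hi (ae_of_all _ fun x ↦ (hbd x).2)
  have hL (k : ℕ) : MemLp ((window k).indicator s) 2 volume :=
    (memLp_indicator_iff_restrict measurableSet_Ioc).2 (hsL k)
  have hY (k : ℕ) := isWienerIntegral_wienerIntegral hW (b := (k + 1 : ℕ) * h)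
    (mul_nonneg k.cast_nonneg hh) (hL k)
  have horth (i j : ℕ) (hij : i ≠ j) :
      ∫ x, (window i).indicator s x * (window j).indicator s x = 0 := by
    refine integral_eq_zero_of_ae (ae_of_all _ fun x ↦ ?_)
    by_cases hx : x ∈ window i
    · have hxj := Set.disjoint_left.1 (hmono.pairwise_disjoint_on_Ioc_succ hij) hx
      exact mul_eq_zero_of_right _ (Set.indicator_of_notMem hxj s)
    · exact mul_eq_zero_of_left (Set.indicator_of_notMem hx s) _
  have hYm (k : ℕ) := (hY k).memLp.aestronglyMeasurable.aemeasurable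
  refine ⟨fun k ↦ (hYm k).mk, ⟨fun k ↦ (hYm k).measurable_mk,
    (iIndepFun_of_isWienerIntegral hW hL hY horth).congr fun k ↦ (hYm k).ae_eq_mk, fun k ↦ ?_⟩,
    fun k ↦ (hYm k).ae_eq_mk⟩
  have hvar := integral_indicator_Ioc_sq_mem_Icc hlo (hmono k.le_succ) (hsL k) hbd
  have hlength : (k + 1 : ℕ) * h - k * h = h := by
    push_cast
    ring
  simp only [Nat.succ_eq_add_one, hlength] at hvar
  refine ⟨_, (Measure.map_congr (hYm k).ae_eq_mk).symm.trans ((hY k).map_eq_gaussianReal hW (hL k)),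
    ?_⟩
  rw [Real.coe_toNNReal _ (integral_nonneg fun x ↦ sq_nonneg _)]
  exact hvar

lemma aemeasurable_wienerIntegral (f : ℝ → ℝ) (a b : ℝ) :
    AEMeasurable (wienerIntegral W P f a b) P := by
  unfold wienerIntegral
  split_ifs with h
  · exact h.choose_spec.memLp.aestronglyMeasurable.aemeasurable
  · exact aemeasurable_const

namespace Model

variable {M : Model}

/-! ### The observation times -/

lemma dt_nonneg (hT : 0 ≤ M.T) (N : ℕ) : 0 ≤ M.dt N := div_nonneg hT N.cast_nonneg

lemma time_zero (N : ℕ) : M.time N 0 = 0 := by simp [time]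

lemma time_self {N : ℕ} (hN : N ≠ 0) : M.time N N = M.T :=
  mul_div_cancel₀ _ (Nat.cast_ne_zero.2 hN)

lemma time_succ_sub (N k : ℕ) : M.time N (k + 1) - M.time N k = M.dt N := by
  simp only [time, Nat.cast_add_one]
  ring

lemma time_mono (hT : 0 ≤ M.T) (N : ℕ) : Monotone (M.time N) := fun _ _ h ↦
  mul_le_mul_of_nonneg_right (Nat.cast_le.2 h) (dt_nonneg hT N)

lemma time_nonneg (hT : 0 ≤ M.T) (N k : ℕ) : 0 ≤ M.time N k :=
  mul_nonneg k.cast_nonneg (dt_nonneg hT N)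

lemma time_succ_le (hT : 0 ≤ M.T) {N k : ℕ} (hk : k < N) : M.time N (k + 1) ≤ M.T :=
  (time_mono hT N (Nat.succ_le_of_lt hk)).trans_eq (time_self (Nat.ne_zero_of_lt hk))

lemma Ioc_time_subset (hT : 0 ≤ M.T) {N k : ℕ} (hk : k < N) :
    Set.Ioc (M.time N k) (M.time N (k + 1)) ⊆ Set.Ioc 0 M.T :=
  Set.Ioc_subset_Ioc (time_nonneg hT N k) (time_succ_le hT hk)

lemma intervalIntegrable_time (hT : 0 ≤ M.T) {f : ℝ → ℝ} (hf : IntegrableOn f (Set.Ioc 0 M.T))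
    {N k : ℕ} (hk : k < N) : IntervalIntegrable f volume (M.time N k) (M.time N (k + 1)) :=
  (intervalIntegrable_iff_integrableOn_Ioc_of_le (time_mono hT N k.le_succ)).2
    (hf.mono_set (Ioc_time_subset hT hk))

lemma sum_abs_integral_time_le (hT : 0 ≤ M.T) {f : ℝ → ℝ} (hf : IntegrableOn f (Set.Ioc 0 M.T))
    (N : ℕ) :
    ∑ k ∈ Finset.range N, |∫ t in (M.time N k)..(M.time N (k + 1)), f t|
      ≤ ∫ t in 0..M.T, |f t| := by
  rcases eq_or_ne N 0 with rfl | hN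
  · simpa using intervalIntegral.integral_nonneg hT fun t _ ↦ abs_nonneg (f t)
  calc ∑ k ∈ Finset.range N, |∫ t in (M.time N k)..(M.time N (k + 1)), f t|
      ≤ ∑ k ∈ Finset.range N, ∫ t in (M.time N k)..(M.time N (k + 1)), |f t| :=
        Finset.sum_le_sum fun k _ ↦
          intervalIntegral.abs_integral_le_integral_abs (time_mono hT N k.le_succ)
    _ = ∫ t in 0..M.T, |f t| := by
        rw [intervalIntegral.sum_integral_adjacent_intervals fun k hk ↦
          (intervalIntegrable_time hT hf hk).abs, time_zero, time_self hN]

lemma abs_integral_time_le (hT : 0 ≤ M.T) {f : ℝ → ℝ}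
    (hf : MemLp f ∞ (volume.restrict (Set.Ioc 0 M.T))) {N k : ℕ} (hk : k < N) :
    |∫ t in (M.time N k)..(M.time N (k + 1)), f t|
      ≤ lpNorm f ∞ (volume.restrict (Set.Ioc 0 M.T)) * M.dt N := by
  have hbd := (ae_restrict_iff' measurableSet_Ioc).1 (ae_le_lpNorm_exponent_top hf)
  have hle := time_mono hT N k.le_succ
  refine (intervalIntegral.norm_integral_le_of_norm_le_const_ae (hbd.mono fun t ht hmem ↦
    ht (Ioc_time_subset hT hk (Set.uIoc_of_le hle ▸ hmem)))).trans_eq ?_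
  rw [time_succ_sub, abs_of_nonneg (dt_nonneg hT N)]

/-! ### Realised variances -/

lemma v_eq_ema (N n : ℕ) (ω : Ω) :
    M.v W P N n ω = ema M.lam M.v₀ (M.dt N)
      (fun k ↦ M.S W P (M.time N (k + 1)) ω / M.S W P (M.time N k) ω - 1) n := by
  induction n with
  | zero => rfl
  | succ n ih => rw [v, ema, ih]

lemma u_eq_ema (N n : ℕ) (ω : Ω) :
    M.u W P N n ω = ema M.lam M.v₀ (M.dt N)
      (fun k ↦ wienerIntegral W P M.σ (M.time N k) (M.time N (k + 1)) ω) n := by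
  induction n with
  | zero => rfl
  | succ n ih => rw [u, ema, ih]

lemma v_pos (hT : 0 < M.T) (hlam : M.lam ∈ Set.Ioo (0 : ℝ) 1) (hv₀ : 0 < M.v₀) {N : ℕ} (hN : N ≠ 0)
    (n : ℕ) (ω : Ω) : 0 < M.v W P N n ω :=
  v_eq_ema N n ω ▸ ema_pos hlam hv₀ (div_pos hT (by positivity)) n

lemma u_pos (hT : 0 < M.T) (hlam : M.lam ∈ Set.Ioo (0 : ℝ) 1) (hv₀ : 0 < M.v₀) {N : ℕ} (hN : N ≠ 0)
    (n : ℕ) (ω : Ω) : 0 < M.u W P N n ω :=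
  u_eq_ema N n ω ▸ ema_pos hlam hv₀ (div_pos hT (by positivity)) n

lemma aemeasurable_S (t : ℝ) : AEMeasurable (M.S W P t) P :=
  ((aemeasurable_wienerIntegral M.σ 0 t).const_add _).exp.const_mul _

lemma aemeasurable_v (N n : ℕ) : AEMeasurable (M.v W P N n) P := by
  simp only [funext (v_eq_ema N n)]
  exact aemeasurable_ema n fun k ↦ ((aemeasurable_S _).div (aemeasurable_S _)).sub_const 1

lemma aemeasurable_u (N n : ℕ) : AEMeasurable (M.u W P N n) P := by
  simp only [funext (u_eq_ema N n)]
  exact aemeasurable_ema n fun k ↦ aemeasurable_wienerIntegral _ _ _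

/-! ### The logarithm of the index -/

/-- The difference of the drifts of the logarithms of the indices with realised variances `q`
and `p`: the first sum in `Model.remainder`. -/
noncomputable def driftDiff (M : Model) (N : ℕ) (q p : ℕ → Ω → ℝ) (ω : Ω) : ℝ :=
  ∑ k ∈ Finset.range N, (M.leverage (q k ω) - M.leverage (p k ω)) *
    ∫ t in (M.time N k)..(M.time N (k + 1)), (M.ρ t - M.r t)

/-- The difference of the integrated variances of the indices with realised variances `q`
and `p`: the second sum in `Model.remainder`. -/
noncomputable def varianceDiff (M : Model) (N : ℕ) (q p : ℕ → Ω → ℝ) (ω : Ω) : ℝ :=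
  ∑ k ∈ Finset.range N, (M.sbar ^ 2 / q k ω - M.sbar ^ 2 / p k ω) *
    ∫ t in (M.time N k)..(M.time N (k + 1)), M.σ t ^ 2

/-- The difference of the martingale parts of the logarithms of the indices with realised
variances `q` and `p`: the third sum in `Model.remainder`. -/
noncomputable def martingaleDiff (M : Model) (W : ℝ≥0 → Ω → ℝ) (P : Measure Ω) (N : ℕ)
    (q p : ℕ → Ω → ℝ) (ω : Ω) : ℝ :=
  ∑ k ∈ Finset.range N, (M.leverage (q k ω) - M.leverage (p k ω)) *
    wienerIntegral W P M.σ (M.time N k) (M.time N (k + 1)) ω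

lemma remainder_eq (N : ℕ) :
    M.remainder W P N = M.driftDiff N (M.v W P N) (M.u W P N)
      + (1 / 2 : ℝ) • M.varianceDiff N (M.v W P N) (M.u W P N)
      + M.martingaleDiff W P N (M.v W P N) (M.u W P N) :=
  rfl

lemma leverage_eq_mul_sqrt_inv (q : ℝ) : M.leverage q = M.sbar * √q⁻¹ := by
  rw [leverage, Real.sqrt_inv, div_eq_mul_inv]

lemma leverage_sq {q : ℝ} (hq : 0 ≤ q) : M.leverage q ^ 2 = M.sbar ^ 2 / q := by
  rw [leverage, div_pow, Real.sq_sqrt hq]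

lemma measurable_leverage : Measurable M.leverage :=
  measurable_const.div Real.continuous_sqrt.measurable

lemma aemeasurable_remainder (N : ℕ) : AEMeasurable (M.remainder W P N) P := by
  have hv := aemeasurable_v (M := M) (W := W) (P := P) N
  have hu := aemeasurable_u (M := M) (W := W) (P := P) N
  have hw (k : ℕ) := (measurable_leverage (M := M).comp_aemeasurable (hv k)).sub
    (measurable_leverage (M := M).comp_aemeasurable (hu k))
  have hw2 (k : ℕ) := ((hv k).const_div (M.sbar ^ 2)).sub ((hu k).const_div (M.sbar ^ 2))
  exact ((Finset.aemeasurable_fun_sum _ fun k _ ↦ (hw k).mul_const _).add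
    ((Finset.aemeasurable_fun_sum _ fun k _ ↦ (hw2 k).mul_const _).const_mul _)).add
    (Finset.aemeasurable_fun_sum _ fun k _ ↦ (hw k).mul (aemeasurable_wienerIntegral _ _ _))

lemma index_pos (hI₀ : 0 < M.I₀) (N : ℕ) (q : ℕ → Ω → ℝ) (n : ℕ) (ω : Ω) :
    0 < M.index W P N q n ω := by
  induction n with
  | zero => exact hI₀
  | succ n ih => exact mul_pos ih (Real.exp_pos _)

section Index

variable {q p : ℕ → Ω → ℝ} {N n : ℕ}

lemma integral_index_drift {a b : ℝ} (hr : IntervalIntegrable M.r volume a b)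
    (hρ : IntervalIntegrable M.ρ volume a b)
    (hσ : IntervalIntegrable (fun t ↦ M.σ t ^ 2) volume a b) (w : ℝ) :
    ∫ t in a..b, ((1 - w) * M.r t + w * M.ρ t - w ^ 2 * M.σ t ^ 2 / 2)
      = (∫ t in a..b, M.r t) + w * (∫ t in a..b, (M.ρ t - M.r t))
        - w ^ 2 / 2 * ∫ t in a..b, M.σ t ^ 2 := by
  have hregroup (t : ℝ) : (1 - w) * M.r t + w * M.ρ t - w ^ 2 * M.σ t ^ 2 / 2
      = M.r t + w * (M.ρ t - M.r t) - w ^ 2 / 2 * M.σ t ^ 2 := by ring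
  simp_rw [hregroup]
  rw [intervalIntegral.integral_sub (hr.add ((hρ.sub hr).const_mul w)) (hσ.const_mul _),
    intervalIntegral.integral_add hr ((hρ.sub hr).const_mul w),
    intervalIntegral.integral_const_mul, intervalIntegral.integral_const_mul]

variable (hT : 0 ≤ M.T) (hr : IntegrableOn M.r (Set.Ioc 0 M.T))
  (hρ : IntegrableOn M.ρ (Set.Ioc 0 M.T)) (hσ : IntegrableOn (fun t ↦ M.σ t ^ 2) (Set.Ioc 0 M.T))
include hT hr hρ hσ

lemma index_succ (hn : n < N) (ω : Ω) :
    M.index W P N q (n + 1) ω = M.index W P N q n ω * Real.exp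
      ((∫ t in (M.time N n)..(M.time N (n + 1)), M.r t)
        + M.leverage (q n ω) * (∫ t in (M.time N n)..(M.time N (n + 1)), (M.ρ t - M.r t))
        - M.leverage (q n ω) ^ 2 / 2 * (∫ t in (M.time N n)..(M.time N (n + 1)), M.σ t ^ 2)
        + M.leverage (q n ω) * wienerIntegral W P M.σ (M.time N n) (M.time N (n + 1)) ω) := by
  rw [index, integral_index_drift (intervalIntegrable_time hT hr hn)
    (intervalIntegrable_time hT hρ hn) (intervalIntegrable_time hT hσ hn)]

lemma aemeasurable_index (hq : ∀ k, AEMeasurable (q k) P) (hn : n ≤ N) :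
    AEMeasurable (M.index W P N q n) P := by
  induction n with
  | zero => exact aemeasurable_const
  | succ n ih =>
    have hw : AEMeasurable (fun ω ↦ M.leverage (q n ω)) P :=
      measurable_leverage.comp_aemeasurable (hq n)
    simp only [funext (index_succ hT hr hρ hσ hn)]
    exact (ih (Nat.le_of_succ_le hn)).mul
      ((((hw.mul_const _).const_add _).sub (((hw.pow_const 2).div_const 2).mul_const _)).add
        (hw.mul (aemeasurable_wienerIntegral _ _ _))).exp

lemma log_index_sub_log_index (hI₀ : 0 < M.I₀) {ω : Ω} (hq : ∀ k < N, 0 ≤ q k ω)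
    (hp : ∀ k < N, 0 ≤ p k ω) :
    Real.log (M.index W P N q N ω) - Real.log (M.index W P N p N ω)
      = M.driftDiff N q p ω + -(1 / 2) * M.varianceDiff N q p ω
        + M.martingaleDiff W P N q p ω := by
  have hstep {q' : ℕ → Ω → ℝ} (hq' : ∀ k < N, 0 ≤ q' k ω) {k : ℕ} (hk : k < N) :
      Real.log (M.index W P N q' (k + 1) ω) - Real.log (M.index W P N q' k ω)
        = (∫ t in (M.time N k)..(M.time N (k + 1)), M.r t)
          + M.leverage (q' k ω) * (∫ t in (M.time N k)..(M.time N (k + 1)), (M.ρ t - M.r t))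
          - M.sbar ^ 2 / q' k ω / 2 * (∫ t in (M.time N k)..(M.time N (k + 1)), M.σ t ^ 2)
          + M.leverage (q' k ω) * wienerIntegral W P M.σ (M.time N k) (M.time N (k + 1)) ω := by
    rw [index_succ hT hr hρ hσ hk, Real.log_mul (index_pos hI₀ N q' k ω).ne' (Real.exp_ne_zero _),
      Real.log_exp, leverage_sq (hq' k hk), add_sub_cancel_left]
  have htelescope (q' : ℕ → Ω → ℝ) : Real.log (M.index W P N q' N ω) = Real.log M.I₀
      + ∑ k ∈ Finset.range N,
        (Real.log (M.index W P N q' (k + 1) ω) - Real.log (M.index W P N q' k ω)) := by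
    rw [Finset.sum_range_sub fun k ↦ Real.log (M.index W P N q' k ω)]
    exact (add_sub_cancel _ _).symm
  rw [htelescope q, htelescope p, add_sub_add_left_eq_sub, ← Finset.sum_sub_distrib, driftDiff,
    varianceDiff, martingaleDiff, Finset.mul_sum, ← Finset.sum_add_distrib,
    ← Finset.sum_add_distrib]
  refine Finset.sum_congr rfl fun k hk ↦ ?_
  rw [hstep hq (Finset.mem_range.1 hk), hstep hp (Finset.mem_range.1 hk)]
  ring

end Index

variable {lo hi : ℝ} {ξ : ℕ → ℕ → Ω → ℝ}

/-! ### Realised variances in terms of Gaussian increments -/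

/-- Measurable versions `ξ N k` of the increments `∫ σ dW` over the observation windows. Each row
is continued beyond the horizon, that is to `k ≥ N`, by some further independent Gaussian
increments. -/
structure IsIncrementVersion (M : Model) (W : ℝ≥0 → Ω → ℝ) (P : Measure Ω) (lo hi : ℝ)
    (ξ : ℕ → ℕ → Ω → ℝ) : Prop where
  isGaussianIncrements : ∀ N : ℕ, IsGaussianIncrements P lo hi (M.T / N) (ξ N)
  ae_eq : ∀ N, ∀ k < N, wienerIntegral W P M.σ (M.time N k) (M.time N (k + 1)) =ᵐ[P] ξ N k

/-- The mean of the logarithmic return of the risky asset over the observation window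
`[tₖ, tₖ₊₁]`. -/
noncomputable def logDrift (M : Model) (N k : ℕ) : ℝ :=
  ∫ t in (M.time N k)..(M.time N (k + 1)), (M.ρ t - M.σ t ^ 2 / 2)

/-- The version of the realised variance `Model.v` computed from versions `ξ` of the increments
`∫ σ dW`, which is measurable with respect to their past. -/
noncomputable def vVersion (M : Model) (ξ : ℕ → ℕ → Ω → ℝ) (N k : ℕ) (ω : Ω) : ℝ :=
  ema M.lam M.v₀ (M.dt N) (fun j ↦ Real.exp (M.logDrift N j + ξ N j ω) - 1) k

/-- The version of the simplified realised variance `Model.u` computed from versions `ξ` of the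
increments `∫ σ dW`, which is measurable with respect to their past. -/
noncomputable def uVersion (M : Model) (ξ : ℕ → ℕ → Ω → ℝ) (N k : ℕ) (ω : Ω) : ℝ :=
  ema M.lam M.v₀ (M.dt N) (fun j ↦ ξ N j ω) k

lemma exists_isIncrementVersion (hW : IsPreBrownianReal W P) (hT : 0 ≤ M.T)
    (hσ : MemLp M.σ ∞ (volume.restrict (Set.Ioc 0 M.T))) (hlo : 0 ≤ lo)
    (hσlo : ∀ᵐ t ∂(volume.restrict (Set.Ioc 0 M.T)), lo ≤ |M.σ t|) :
    ∃ hi ξ, M.IsIncrementVersion W P (lo ^ 2) hi ξ := by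
  obtain ⟨hi, s, hs, hbd, hσs⟩ := exists_measurable_ae_eq_abs_mem_Icc hσ hσlo
  choose ξ hξ hae using fun N ↦ exists_isGaussianIncrements hW hs hlo hbd (dt_nonneg hT N)
  refine ⟨hi ^ 2, ξ, hξ, fun N k hk ↦ ?_⟩
  rw [wienerIntegral_congr (g := s)]
  · exact hae N k
  · filter_upwards [(ae_restrict_iff' measurableSet_Ioc).1 hσs] with t ht
    by_cases hmem : t ∈ Set.Ioc (M.time N k) (M.time N (k + 1))
    · simp only [Set.indicator_of_mem hmem, ht (Ioc_time_subset hT hk hmem)]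
    · simp only [Set.indicator_of_notMem hmem]

lemma S_div_S_ae_eq (hW : IsPreBrownianReal W P) (hS₀ : M.S₀ ≠ 0)
    (hint : IntegrableOn (fun t ↦ M.ρ t - M.σ t ^ 2 / 2) (Set.Ioc 0 M.T))
    (hσ : MemLp M.σ 2 (volume.restrict (Set.Ioc 0 M.T))) {a b : ℝ} (ha : 0 ≤ a) (hab : a ≤ b)
    (hbT : b ≤ M.T) :
    ∀ᵐ ω ∂P, M.S W P b ω / M.S W P a ω
      = Real.exp ((∫ t in a..b, (M.ρ t - M.σ t ^ 2 / 2)) + wienerIntegral W P M.σ a b ω) := by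
  have hsub₁ : Set.Ioc 0 a ⊆ Set.Ioc 0 M.T := Set.Ioc_subset_Ioc_right (hab.trans hbT)
  have hsub₂ : Set.Ioc a b ⊆ Set.Ioc 0 M.T := Set.Ioc_subset_Ioc ha hbT
  have hL {c d : ℝ} (h : Set.Ioc c d ⊆ Set.Ioc 0 M.T) :
      MemLp ((Set.Ioc c d).indicator M.σ) 2 volume :=
    (memLp_indicator_iff_restrict measurableSet_Ioc).2
      (hσ.mono_measure (Measure.restrict_mono_set _ h))
  filter_upwards [wienerIntegral_add_adjacent hW le_rfl ha hab (hL hsub₁) (hL hsub₂)] with ω hω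
  rw [S, S, hω, mul_div_mul_left _ _ hS₀, ← Real.exp_sub,
    ← intervalIntegral.integral_add_adjacent_intervals
      ((intervalIntegrable_iff_integrableOn_Ioc_of_le ha).2 (hint.mono_set hsub₁))
      ((intervalIntegrable_iff_integrableOn_Ioc_of_le hab).2 (hint.mono_set hsub₂))]
  congr 1
  simp only [Pi.add_apply]
  ring

namespace IsIncrementVersion

variable (hξ : M.IsIncrementVersion W P lo hi ξ)
include hξ

lemma ae_forall_eq (N : ℕ) : ∀ᵐ ω ∂P, ∀ k < N,
    wienerIntegral W P M.σ (M.time N k) (M.time N (k + 1)) ω = ξ N k ω :=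
  ae_all_iff.2 fun k ↦ eventually_imp_distrib_left.2 (hξ.ae_eq N k)

lemma u_ae_eq {N k : ℕ} (hk : k ≤ N) : M.u W P N k =ᵐ[P] M.uVersion ξ N k := by
  filter_upwards [hξ.ae_forall_eq N] with ω hω
  exact (u_eq_ema N k ω).trans (ema_congr fun j hj ↦ hω j (hj.trans_le hk))

lemma v_ae_eq (hW : IsPreBrownianReal W P) (hT : 0 ≤ M.T) (hS₀ : M.S₀ ≠ 0)
    (hint : IntegrableOn (fun t ↦ M.ρ t - M.σ t ^ 2 / 2) (Set.Ioc 0 M.T))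
    (hσ : MemLp M.σ 2 (volume.restrict (Set.Ioc 0 M.T))) {N k : ℕ} (hk : k ≤ N) :
    M.v W P N k =ᵐ[P] M.vVersion ξ N k := by
  have hreturn : ∀ᵐ ω ∂P, ∀ j < N, M.S W P (M.time N (j + 1)) ω / M.S W P (M.time N j) ω
      = Real.exp (M.logDrift N j + wienerIntegral W P M.σ (M.time N j) (M.time N (j + 1)) ω) :=
    ae_all_iff.2 fun j ↦ eventually_imp_distrib_left.2 fun hj ↦ S_div_S_ae_eq hW hS₀ hint hσ
      (time_nonneg hT N j) (time_mono hT N j.le_succ) (time_succ_le hT hj)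
  filter_upwards [hξ.ae_forall_eq N, hreturn] with ω hω hωreturn
  refine (v_eq_ema N k ω).trans (ema_congr fun j hj ↦ ?_)
  rw [hωreturn j (hj.trans_le hk), hω j (hj.trans_le hk)]

lemma measurable_uVersion (N k : ℕ) :
    Measurable[pastFiltration (ξ N) (hξ.isGaussianIncrements N).measurable k]
      (M.uVersion ξ N k) :=
  measurable_ema k fun _ hj ↦ measurable_pastFiltration _ hj

lemma measurable_vVersion (N k : ℕ) :
    Measurable[pastFiltration (ξ N) (hξ.isGaussianIncrements N).measurable k]
      (M.vVersion ξ N k) :=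
  measurable_ema k fun _ hj ↦ ((measurable_pastFiltration _ hj).const_add _).exp.sub_const 1

lemma rowsTendstoZeroInMeasure_inv_vVersion_sub_inv_uVersion [IsFiniteMeasure P] (hT : 0 < M.T)
    (hlo : 0 < lo) (hlam : M.lam ∈ Set.Ioo (0 : ℝ) 1) (hv₀ : 0 < M.v₀)
    (hlogDrift : MemLp (fun t ↦ M.ρ t - M.σ t ^ 2 / 2) ∞ (volume.restrict (Set.Ioc 0 M.T))) :
    RowsTendstoZeroInMeasure P fun N k ω ↦ (M.vVersion ξ N k ω)⁻¹ - (M.uVersion ξ N k ω)⁻¹ :=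
  rowsTendstoZeroInMeasure_inv_ema_sub hT hξ.isGaussianIncrements hlo hlam hv₀ lpNorm_nonneg
    fun _ _ hk ↦ abs_integral_time_le hT.le hlogDrift hk

end IsIncrementVersion

/-! ### Convergence of the three differences -/

section Differences

variable [IsFiniteMeasure P] {q p : ℕ → ℕ → Ω → ℝ}

lemma rowsTendstoZeroInMeasure_leverage_sub
    (h : RowsTendstoZeroInMeasure P fun N k ω ↦ (q N k ω)⁻¹ - (p N k ω)⁻¹) :
    RowsTendstoZeroInMeasure P fun N k ω ↦ M.leverage (q N k ω) - M.leverage (p N k ω) := by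
  simp only [leverage_eq_mul_sqrt_inv, ← mul_sub]
  exact h.sqrt_sub_sqrt.const_mul M.sbar

lemma tendstoInMeasure_driftDiff (hT : 0 ≤ M.T)
    (hint : IntegrableOn (fun t ↦ M.ρ t - M.r t) (Set.Ioc 0 M.T))
    (h : RowsTendstoZeroInMeasure P fun N k ω ↦ (q N k ω)⁻¹ - (p N k ω)⁻¹) :
    TendstoInMeasure P (fun N ↦ M.driftDiff N (q N) (p N)) atTop 0 :=
  (rowsTendstoZeroInMeasure_leverage_sub h).tendstoInMeasure_sum_mul
    (sum_abs_integral_time_le hT hint)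

lemma tendstoInMeasure_varianceDiff (hT : 0 ≤ M.T)
    (hint : IntegrableOn (fun t ↦ M.σ t ^ 2) (Set.Ioc 0 M.T))
    (h : RowsTendstoZeroInMeasure P fun N k ω ↦ (q N k ω)⁻¹ - (p N k ω)⁻¹) :
    TendstoInMeasure P (fun N ↦ M.varianceDiff N (q N) (p N)) atTop 0 := by
  have hrows := h.const_mul (M.sbar ^ 2)
  simp only [mul_sub, ← div_eq_mul_inv] at hrows
  exact hrows.tendstoInMeasure_sum_mul (sum_abs_integral_time_le hT hint)

lemma IsIncrementVersion.tendstoInMeasure_martingaleDiff (hξ : M.IsIncrementVersion W P lo hi ξ)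
    (h : RowsTendstoZeroInMeasure P fun N k ω ↦ (q N k ω)⁻¹ - (p N k ω)⁻¹)
    (hq : ∀ N k,
      Measurable[pastFiltration (ξ N) (hξ.isGaussianIncrements N).measurable k] (q N k))
    (hp : ∀ N k,
      Measurable[pastFiltration (ξ N) (hξ.isGaussianIncrements N).measurable k] (p N k)) :
    TendstoInMeasure P (fun N ↦ M.martingaleDiff W P N (q N) (p N)) atTop 0 := by
  refine ((rowsTendstoZeroInMeasure_leverage_sub (M := M) h).tendstoInMeasure_sum_mul_gaussian
    hξ.isGaussianIncrements fun N k ↦ (measurable_leverage.comp (hq N k)).sub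
      (measurable_leverage.comp (hp N k))).congr_left fun N ↦ ?_
  filter_upwards [hξ.ae_forall_eq N] with ω hω
  exact Finset.sum_congr rfl fun k hk ↦ by rw [hω k (Finset.mem_range.1 hk)]

omit [IsFiniteMeasure P] in
lemma martingaleDiff_congr_ae {N : ℕ} {q q' p p' : ℕ → Ω → ℝ} (hq : ∀ k < N, q k =ᵐ[P] q' k)
    (hp : ∀ k < N, p k =ᵐ[P] p' k) :
    M.martingaleDiff W P N q p =ᵐ[P] M.martingaleDiff W P N q' p' := by
  have hrow {f g : ℕ → Ω → ℝ} (h : ∀ k < N, f k =ᵐ[P] g k) : ∀ᵐ ω ∂P, ∀ k < N, f k ω = g k ω :=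
    ae_all_iff.2 fun k ↦ eventually_imp_distrib_left.2 (h k)
  filter_upwards [hrow hq, hrow hp] with ω hωq hωp
  exact Finset.sum_congr rfl fun k hk ↦ by
    rw [hωq k (Finset.mem_range.1 hk), hωp k (Finset.mem_range.1 hk)]

end Differences

end Model

lemma TendstoLaw.of_log_sub_log [IsProbabilityMeasure P] {Y Z : ℕ → Ω → ℝ}
    {ν : ProbabilityMeasure ℝ} (hY : TendstoLaw P Y ν) (hYpos : ∀ N ω, 0 < Y N ω)
    (hZpos : ∀ N ω, 0 < Z N ω) (hZ : ∀ N, AEMeasurable (Z N) P)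
    (h : TendstoInMeasure P (fun N ω ↦ Real.log (Y N ω) - Real.log (Z N ω)) atTop 0) :
    TendstoLaw P Z ν := by
  have hcont : Continuous fun p : ℝ × ℝ ↦ p.1 * Real.exp (-p.2) := by fun_prop
  have hlog (N : ℕ) : AEMeasurable (fun ω ↦ Real.log (Y N ω) - Real.log (Z N ω)) P :=
    (Real.measurable_log.comp_aemeasurable (hY.forall_aemeasurable N)).sub
      (Real.measurable_log.comp_aemeasurable (hZ N))
  have hslutsky :=
    hY.continuous_comp_prodMk_of_tendstoInMeasure_const (c := (0 : ℝ)) hcont h hlog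
  refine hslutsky.congr (fun N ↦ ae_of_all _ fun ω ↦ ?_) (ae_of_all _ fun x ↦ by simp)
  simp only [neg_sub]
  rw [Real.exp_sub, Real.exp_log (hYpos N ω), Real.exp_log (hZpos N ω),
    mul_div_cancel₀ _ (hYpos N ω).ne']

lemma tendstoLaw_iff_of_log_sub_log [IsProbabilityMeasure P] {Y Z : ℕ → Ω → ℝ}
    (hYpos : ∀ N ω, 0 < Y N ω) (hZpos : ∀ N ω, 0 < Z N ω) (hY : ∀ N, AEMeasurable (Y N) P)
    (hZ : ∀ N, AEMeasurable (Z N) P)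
    (h : TendstoInMeasure P (fun N ω ↦ Real.log (Y N ω) - Real.log (Z N ω)) atTop 0)
    (ν : ProbabilityMeasure ℝ) : TendstoLaw P Y ν ↔ TendstoLaw P Z ν := by
  have hneg : TendstoInMeasure P (fun N ω ↦ Real.log (Z N ω) - Real.log (Y N ω)) atTop 0 := by
    refine (tendstoInMeasure_zero_const_smul h (-1)).congr_left fun N ↦ ae_of_all _ fun ω ↦ ?_
    simp
  exact ⟨fun hYν ↦ hYν.of_log_sub_log hYpos hZpos hZ h,
    fun hZν ↦ hZν.of_log_sub_log hZpos hYpos hY hneg⟩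

namespace Model

variable {M : Model}

namespace IsIncrementVersion

variable {lo hi : ℝ} {ξ : ℕ → ℕ → Ω → ℝ} (hξ : M.IsIncrementVersion W P lo hi ξ)
  (hW : IsPreBrownianReal W P) (hT : 0 < M.T) (hS₀ : M.S₀ ≠ 0) (hv₀ : 0 < M.v₀)
  (hlam : M.lam ∈ Set.Ioo (0 : ℝ) 1) (hlo : 0 < lo)
  (hlogDrift : MemLp (fun t ↦ M.ρ t - M.σ t ^ 2 / 2) ∞ (volume.restrict (Set.Ioc 0 M.T)))
  (hσ : MemLp M.σ 2 (volume.restrict (Set.Ioc 0 M.T)))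
include hξ hW hT hS₀ hv₀ hlam hlo hlogDrift hσ

lemma rowsTendstoZeroInMeasure_inv_v_sub_inv_u [IsFiniteMeasure P] :
    RowsTendstoZeroInMeasure P fun N k ω ↦ (M.v W P N k ω)⁻¹ - (M.u W P N k ω)⁻¹ :=
  (hξ.rowsTendstoZeroInMeasure_inv_vVersion_sub_inv_uVersion hT hlo hlam hv₀ hlogDrift).congr_ae
    fun _ _ hk ↦
      (hξ.v_ae_eq hW hT.le hS₀ (hlogDrift.integrable le_top) hσ hk.le).inv.sub
        (hξ.u_ae_eq hk.le).inv |>.symm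

lemma tendstoInMeasure_martingaleDiff_v_u [IsFiniteMeasure P] :
    TendstoInMeasure P (fun N ↦ M.martingaleDiff W P N (M.v W P N) (M.u W P N)) atTop 0 :=
  (hξ.tendstoInMeasure_martingaleDiff
    (hξ.rowsTendstoZeroInMeasure_inv_vVersion_sub_inv_uVersion hT hlo hlam hv₀ hlogDrift)
    hξ.measurable_vVersion hξ.measurable_uVersion).congr_left fun _ ↦ martingaleDiff_congr_ae
      (fun _ hk ↦ (hξ.v_ae_eq hW hT.le hS₀ (hlogDrift.integrable le_top) hσ hk.le).symm)
      (fun _ hk ↦ (hξ.u_ae_eq hk.le).symm)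

end IsIncrementVersion

section Remainder

variable [IsFiniteMeasure P]
  (hdrift : TendstoInMeasure P (fun N ↦ M.driftDiff N (M.v W P N) (M.u W P N)) atTop 0)
  (hvariance : TendstoInMeasure P (fun N ↦ M.varianceDiff N (M.v W P N) (M.u W P N)) atTop 0)
  (hmartingale : TendstoInMeasure P
    (fun N ↦ M.martingaleDiff W P N (M.v W P N) (M.u W P N)) atTop 0)
include hdrift hvariance hmartingale

lemma tendstoInMeasure_remainder : TendstoInMeasure P (M.remainder W P) atTop 0 := by
  rw [funext remainder_eq]
  exact tendstoInMeasure_zero_add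
    (tendstoInMeasure_zero_add hdrift (tendstoInMeasure_zero_const_smul hvariance _)) hmartingale

lemma tendstoInMeasure_log_I_sub_log_X (hT : 0 < M.T) (hI₀ : 0 < M.I₀) (hv₀ : 0 < M.v₀)
    (hlam : M.lam ∈ Set.Ioo (0 : ℝ) 1) (hr : IntegrableOn M.r (Set.Ioc 0 M.T))
    (hρ : IntegrableOn M.ρ (Set.Ioc 0 M.T))
    (hσ : IntegrableOn (fun t ↦ M.σ t ^ 2) (Set.Ioc 0 M.T)) :
    TendstoInMeasure P (fun N ω ↦ Real.log (M.I W P N ω) - Real.log (M.X W P N ω)) atTop 0 := by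
  refine (tendstoInMeasure_zero_add (tendstoInMeasure_zero_add hdrift
    (tendstoInMeasure_zero_const_smul hvariance (-(1 / 2)))) hmartingale).congr_left
    fun N ↦ ae_of_all _ fun ω ↦ ?_
  exact (log_index_sub_log_index hT.le hr hρ hσ hI₀
    (fun k hk ↦ (v_pos hT hlam hv₀ (Nat.ne_zero_of_lt hk) k ω).le)
    (fun k hk ↦ (u_pos hT hlam hv₀ (Nat.ne_zero_of_lt hk) k ω).le)).symm

end Remainder

lemma tendstoInMeasure_driftDiff_varianceDiff_martingaleDiff [IsFiniteMeasure P]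
    (hW : IsPreBrownianReal W P) (hT : 0 < M.T) (hS₀ : M.S₀ ≠ 0) (hv₀ : 0 < M.v₀)
    (hlam : M.lam ∈ Set.Ioo (0 : ℝ) 1) (hr : IntegrableOn M.r (Set.Ioc 0 M.T))
    (hρ : MemLp M.ρ ∞ (volume.restrict (Set.Ioc 0 M.T)))
    (hσ : MemLp M.σ ∞ (volume.restrict (Set.Ioc 0 M.T)))
    {lo : ℝ} (hlo : 0 < lo) (hσlo : ∀ᵐ t ∂(volume.restrict (Set.Ioc 0 M.T)), lo ≤ |M.σ t|) :
    TendstoInMeasure P (fun N ↦ M.driftDiff N (M.v W P N) (M.u W P N)) atTop 0 ∧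
      TendstoInMeasure P (fun N ↦ M.varianceDiff N (M.v W P N) (M.u W P N)) atTop 0 ∧
      TendstoInMeasure P (fun N ↦ M.martingaleDiff W P N (M.v W P N) (M.u W P N)) atTop 0 := by
  have hσ₂ : MemLp M.σ 2 (volume.restrict (Set.Ioc 0 M.T)) := hσ.mono_exponent le_top
  have hlogDrift : MemLp (fun t ↦ M.ρ t - M.σ t ^ 2 / 2) ∞ (volume.restrict (Set.Ioc 0 M.T)) := by
    simp_rw [div_eq_inv_mul, sq]
    exact hρ.sub ((hσ.mul hσ).const_mul _)
  obtain ⟨hi, ξ, hξ⟩ := exists_isIncrementVersion hW hT.le hσ hlo.le hσlo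
  have hrows := hξ.rowsTendstoZeroInMeasure_inv_v_sub_inv_u hW hT hS₀ hv₀ hlam
    (pow_pos hlo 2) hlogDrift hσ₂
  exact ⟨tendstoInMeasure_driftDiff hT.le ((hρ.integrable le_top).sub hr) hrows,
    tendstoInMeasure_varianceDiff hT.le hσ₂.integrable_sq hrows,
    hξ.tendstoInMeasure_martingaleDiff_v_u hW hT hS₀ hv₀ hlam (pow_pos hlo 2) hlogDrift hσ₂⟩

end Model

end VolTarget

open VolTarget Model in
theorem mainTheorem5_general {Ω : Type*} [MeasurableSpace Ω] (P : Measure Ω)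
    [IsProbabilityMeasure P] (W : ℝ≥0 → Ω → ℝ) (hW : IsPreBrownianReal W P) (M : Model)
    (hT : 0 < M.T) (hS₀ : 0 < M.S₀) (hI₀ : 0 < M.I₀) (hv₀ : 0 < M.v₀)
    (hlam : M.lam ∈ Set.Ioo (0 : ℝ) 1) (hr : IntegrableOn M.r (Set.Ioo 0 M.T))
    (hρ : MemLp M.ρ ∞ (volume.restrict (Set.Ioo 0 M.T)))
    (hσ : MemLp M.σ ∞ (volume.restrict (Set.Ioo 0 M.T))) (σlo : ℝ) (hσlo : 0 < σlo)
    (hσbd : ∀ᵐ t ∂(volume.restrict (Set.Ioo 0 M.T)), σlo ≤ |M.σ t|) :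
    TendstoInDistribution (fun (N : ℕ) ω ↦ Real.log (M.I W P N ω) - Real.log (M.X W P N ω)) atTop
        (fun _ : Ω ↦ (0 : ℝ)) (fun _ ↦ P) P ∧
      TendstoInDistribution (fun (N : ℕ) ω ↦ M.remainder W P N ω) atTop
        (fun _ : Ω ↦ (0 : ℝ)) (fun _ ↦ P) P ∧
      ((∃ ν, TendstoLaw P (M.I W P) ν) ↔ ∃ ν, TendstoLaw P (M.X W P) ν) ∧
      ∀ ν, TendstoLaw P (M.I W P) ν ↔ TendstoLaw P (M.X W P) ν := by
  rw [IntegrableOn] at hr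
  rw [Measure.restrict_congr_set Ioo_ae_eq_Ioc] at hr hρ hσ hσbd
  have hρ₁ := hρ.integrable le_top
  have hσ₂ := (hσ.mono_exponent (p := 2) le_top).integrable_sq
  obtain ⟨hdrift, hvariance, hmartingale⟩ :=
    tendstoInMeasure_driftDiff_varianceDiff_martingaleDiff hW hT hS₀.ne' hv₀ hlam hr hρ hσ hσlo hσbd
  have hremainder := tendstoInMeasure_remainder hdrift hvariance hmartingale
  have hlog := tendstoInMeasure_log_I_sub_log_X hdrift hvariance hmartingale hT hI₀ hv₀ hlam hr
    hρ₁ hσ₂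
  have hIpos (N : ℕ) (ω : Ω) : 0 < M.I W P N ω := index_pos hI₀ N _ N ω
  have hXpos (N : ℕ) (ω : Ω) : 0 < M.X W P N ω := index_pos hI₀ N _ N ω
  have hI (N : ℕ) : AEMeasurable (M.I W P N) P :=
    aemeasurable_index hT.le hr hρ₁ hσ₂ (aemeasurable_v N) le_rfl
  have hX (N : ℕ) : AEMeasurable (M.X W P N) P :=
    aemeasurable_index hT.le hr hρ₁ hσ₂ (aemeasurable_u N) le_rfl
  have hlaw := tendstoLaw_iff_of_log_sub_log hIpos hXpos hI hX hlog
  exact ⟨hlog.tendstoInDistribution fun N ↦ (hI N).log.sub (hX N).log,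
    hremainder.tendstoInDistribution aemeasurable_remainder, exists_congr hlaw, hlaw⟩

theorem mainTheorem5 {Ω : Type*} [MeasurableSpace Ω] (P : Measure Ω) [IsProbabilityMeasure P]
    (W : ℝ≥0 → Ω → ℝ) (hW : IsBrownianReal W P) (M : VolTarget.Model)
    (hT : 0 < M.T) (hS₀ : 0 < M.S₀) (hI₀ : 0 < M.I₀) (hv₀ : 0 < M.v₀)
    (hlam : M.lam ∈ Set.Ioo (0 : ℝ) 1)
    (hr : MemLp M.r ∞ (volume.restrict (Set.Ioo 0 M.T)))
    (hρ : MemLp M.ρ ∞ (volume.restrict (Set.Ioo 0 M.T)))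
    (hσ : MemLp M.σ ∞ (volume.restrict (Set.Ioo 0 M.T)))
    (σlo σhi : ℝ) (hσlo : 0 < σlo)
    (hσbd : ∀ᵐ t ∂(volume.restrict (Set.Ioo 0 M.T)), σlo < M.σ t ∧ M.σ t < σhi) :
    TendstoInDistribution (fun (N : ℕ) ω ↦ Real.log (M.I W P N ω) - Real.log (M.X W P N ω)) atTop
        (fun _ : Ω ↦ (0 : ℝ)) (fun _ ↦ P) P ∧
      TendstoInDistribution (fun (N : ℕ) ω ↦ M.remainder W P N ω) atTop
        (fun _ : Ω ↦ (0 : ℝ)) (fun _ ↦ P) P ∧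
      ((∃ ν, VolTarget.TendstoLaw P (M.I W P) ν) ↔ ∃ ν, VolTarget.TendstoLaw P (M.X W P) ν) ∧
      ∀ ν, VolTarget.TendstoLaw P (M.I W P) ν ↔ VolTarget.TendstoLaw P (M.X W P) ν :=
  mainTheorem5_general P W hW.toIsPreBrownianReal M hT hS₀ hI₀ hv₀ hlam (hr.integrable le_top) hρ hσ
    σlo hσlo (hσbd.mono fun _ ht ↦ ht.1.le.trans (le_abs_self _))
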